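/- Let $(\Omega,\mathcal F,P)$ be a probability space and let $\{\mathcal F_n\}_{n\ge0}$ be a nondecreasing sequence of sub-$\sigma$-algebras of $\mathcal F$ with $\mathcal F=\sigma(\bigcup_n\mathcal F_n)$ and $\mathcal F_0=\{\emptyset,\Omega\}$. Let $E$ and $E_n$ denote expectation and conditional expectation given $\mathcal F_n$. A set $B\in\mathcal F_n$ is an atom of $\mathcal F_n$ if every $A\in\mathcal F_n$ with $A\subset B$ satisfies $P(A)=P(B)$ or $P(A)=0$; assume that each $\mathcal F_n$ is generated by countably many of its atoms, and let $A(\mathcal F_n)$ be the set of atoms of $\mathcal F_n$ of positive probability. Assume that $\{\mathcal F_n\}$ is regular: there is $R\ge2$ such that $f_n\le Rf_{n-1}$ a.s. for all $n\ge1$ and all non-negative martingales $(f_n)_{n\ge0}$. Functions are real- or complex-valued and identified when equal almost surely. For $p\in[1,\infty)$, $\theta:(0,1]\to(0,\infty)$ and $f\in L_1$ put $$\|f\|_{\mathcal L_{p,\theta}}=\sup_{n\ge0}\ \sup_{B\in A(\mathcal F_n)}\frac1{\theta(P(B))}\left(\frac1{P(B)}\int_B|f-E_nf|^p\,dP\right)^{1/p},\qquad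 \|f\|_{\widetilde{\mathcal L}_{p,\theta}}=\|f\|_{\mathcal L_{p,\theta}}+|Ef|,$$ and let $\mathcal L_{p,\theta}=\{f\in L_1:\|f\|_{\mathcal L_{p,\theta}}<\infty\}$ and $\widetilde{\mathcal L}_{p,\theta}=\{f\in L_1:\|f\|_{\widetilde{\mathcal L}_{p,\theta}}<\infty\}$. Let $p\in[1,\infty)$ and let $\phi:(0,1]\to(0,\infty)$ be (Lebesgue) measurable. Assume that $\phi$ satisfies the doubling condition, i.e. there is $C>0$ with $1/C\le\phi(r)/\phi(s)\le C$ whenever $r,s\in(0,1]$ and $1/2\le r/s\le2$, and that there is $C>0$ with $$\int_0^r\phi(t)^p\,dt\le C\,r\,\phi(r)^p\qquad\text{for all } r\in(0,1].$$ Put $\phi_*(r)=1+\int_r^1\frac{\phi(t)}t\,dt$ for $r\in(0,1]$. Let $\mathrm{PWM}(\widetilde{\mathcal L}_{p,\phi})$ be the set of all $\mathcal F$-measurable functions $g$ such that $fg\in\widetilde{\mathcal L}_{p,\phi}$ for every $f\in\widetilde{\mathcal L}_{p,\phi}$, and for such $g$ let $$\|g\|_{Op}=\sup_{f\in\widetilde{\mathcal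 L}_{p,\phi},\ f\not\equiv0}\ \frac{\|fg\|_{\widetilde{\mathcal L}_{p,\phi}}}{\|f\|_{\widetilde{\mathcal L}_{p,\phi}}}.$$ Then $$\mathrm{PWM}(\widetilde{\mathcal L}_{p,\phi})=\mathcal L_{p,\phi/\phi_*}\cap L_\infty .$$ Moreover, there is a constant $C>0$ such that for all $g\in\mathrm{PWM}(\widetilde{\mathcal L}_{p,\phi})$ $$C^{-1}\left(\|g\|_{\mathcal L_{p,\phi/\phi_*}}+\|g\|_{L_\infty}\right)\le\|g\|_{Op}\le C\left(\|g\|_{\mathcal L_{p,\phi/\phi_*}}+\|g\|_{L_\infty}\right).$$ -/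

import Mathlib

open MeasureTheory Set
open scoped ENNReal

namespace MartingaleCampanato

noncomputable section

/-- `B` is an `(m, P)`-atom: `B ∈ m` and every `A ⊆ B` with `A ∈ m` satisfies
`P A = P B` or `P A = 0`.  (Null sets are not excluded here; they are excluded where one divides
by `P B`.) -/
def IsMeasureAtom {Ω : Type*} {m0 : MeasurableSpace Ω} (P : Measure Ω) (m : MeasurableSpace Ω)
    (B : Set Ω) : Prop :=
  MeasurableSet[m] B ∧ ∀ A : Set Ω, A ⊆ B → MeasurableSet[m] A → P A = P B ∨ P A = 0

/-- The σ-algebra `m` is generated by countably many `(m, P)`-atoms. -/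
def GeneratedByCountableAtoms {Ω : Type*} {m0 : MeasurableSpace Ω} (P : Measure Ω)
    (m : MeasurableSpace Ω) : Prop :=
  ∃ S : Set (Set Ω), S.Countable ∧ (∀ B ∈ S, IsMeasureAtom P m B) ∧
    m = MeasurableSpace.generateFrom S

/-- The filtration is regular: there is `R ≥ 2` such that `f_n ≤ R f_{n-1}` almost surely for
every `n ≥ 1` and every non-negative martingale `(f_n)`. -/
def IsRegular {Ω : Type*} {m0 : MeasurableSpace Ω} (P : Measure Ω) (ℱ : Filtration ℕ m0) : Prop :=
  ∃ R : ℝ, 2 ≤ R ∧ ∀ f : ℕ → Ω → ℝ, Martingale f ℱ P → (∀ n, 0 ≤ᵐ[P] f n) →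
    ∀ n, ∀ᵐ ω ∂P, f (n + 1) ω ≤ R * f n ω

/-- The doubling condition for a function on `(0, 1]`. -/
def Doubling (θ : ℝ → ℝ) : Prop :=
  ∃ C : ℝ, 0 < C ∧ ∀ r ∈ Ioc (0 : ℝ) 1, ∀ s ∈ Ioc (0 : ℝ) 1,
    1 / 2 ≤ r / s → r / s ≤ 2 → 1 / C ≤ θ r / θ s ∧ θ r / θ s ≤ C

/-- `∫_0^r φ(t)^p dt ≤ C r φ(r)^p` for all `r ∈ (0, 1]`, with a constant `C` independent of `r`. -/
def IntegralCondition (p : ℝ) (φ : ℝ → ℝ) : Prop :=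
  ∃ C : ℝ, 0 < C ∧ ∀ r ∈ Ioc (0 : ℝ) 1,
    ∫⁻ t in Ioc 0 r, ENNReal.ofReal (φ t ^ p) ≤ ENNReal.ofReal (C * r * φ r ^ p)

/-- `φ_*(r) = 1 + ∫_r^1 φ(t)/t dt`. -/
def lowerStar (φ : ℝ → ℝ) (r : ℝ) : ℝ :=
  1 + ∫ t in r..1, φ t / t

variable {Ω : Type*} {m0 : MeasurableSpace Ω} {𝕜 : Type*} [RCLike 𝕜]

/-- The Campanato seminorm, with values in `[0, ∞]`: the supremum over `n` and over the
`(ℱ n, P)`-atoms `B` of positive measure of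
`φ(P(B))⁻¹ (P(B)⁻¹ ∫_B |f - E_n f|^p dP)^{1/p}`. -/
def campanatoSeminorm (P : Measure Ω) (ℱ : Filtration ℕ m0) (p : ℝ) (φ : ℝ → ℝ)
    (f : Ω → 𝕜) : ℝ≥0∞ :=
  ⨆ (n : ℕ) (B : Set Ω) (_ : IsMeasureAtom P (ℱ n) B) (_ : 0 < P B),
    (ENNReal.ofReal (φ (P.real B)))⁻¹ *
      ((P B)⁻¹ * ∫⁻ ω in B, ‖f ω - (P[f | ℱ n]) ω‖ₑ ^ p ∂P) ^ (1 / p)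

/-- The Campanato norm: the seminorm plus `|E f|`. -/
def campanatoNorm (P : Measure Ω) (ℱ : Filtration ℕ m0) (p : ℝ) (φ : ℝ → ℝ)
    (f : Ω → 𝕜) : ℝ≥0∞ :=
  campanatoSeminorm P ℱ p φ f + ‖∫ ω, f ω ∂P‖ₑ

/-- The Campanato space: the `f ∈ L_1` with finite seminorm. -/
def campanatoSpace (𝕜 : Type*) [RCLike 𝕜] (P : Measure Ω) (ℱ : Filtration ℕ m0) (p : ℝ)
    (φ : ℝ → ℝ) : Set (Ω → 𝕜) :=
  {f | MemLp f 1 P ∧ campanatoSeminorm P ℱ p φ f < ∞}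

/-- The normed Campanato space: the `f ∈ L_1` with finite norm. -/
def normedCampanatoSpace (𝕜 : Type*) [RCLike 𝕜] (P : Measure Ω) (ℱ : Filtration ℕ m0) (p : ℝ)
    (φ : ℝ → ℝ) : Set (Ω → 𝕜) :=
  {f | MemLp f 1 P ∧ campanatoNorm P ℱ p φ f < ∞}

/-- Pointwise multipliers on a set `X` of measurable functions (functions are understood up to
`P`-null sets, so measurability is almost everywhere measurability). -/
def pointwiseMultipliers (P : Measure Ω) (X : Set (Ω → 𝕜)) : Set (Ω → 𝕜) :=
  {g | AEStronglyMeasurable g P ∧ ∀ f ∈ X, f * g ∈ X}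

/-- The operator norm of multiplication by `g` on the normed Campanato space: the supremum of
`‖f g‖ / ‖f‖` over all `f` in the space which do not vanish almost everywhere. -/
def multiplierNorm (P : Measure Ω) (ℱ : Filtration ℕ m0) (p : ℝ) (φ : ℝ → ℝ)
    (g : Ω → 𝕜) : ℝ≥0∞ :=
  ⨆ (f : Ω → 𝕜) (_ : f ∈ normedCampanatoSpace 𝕜 P ℱ p φ) (_ : ¬ f =ᵐ[P] 0),
    campanatoNorm P ℱ p φ (f * g) / campanatoNorm P ℱ p φ f

end

end MartingaleCampanato

namespace MartingaleCampanato

/-! On an atom B of the n-th σ-algebra, E_n f is the mean f_B of f over B, so the Campanato seminorm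
measures the L^p mean oscillation of f on atoms.

Sufficiency: from fg - f_B g_B = (f - f_B) g + f_B (g - g_B), the oscillation of fg on B is at most
2 (‖g‖_∞ osc_B f + |f_B| osc_B g). Descending from Ω to B through successive parents gives |f_B| ≤ K
φ_*(P(B)) ‖f‖ (`exists_enorm_integral_cond_le`). This φ_* cancels the one in the weight φ/φ_* and
yields `exists_campanatoNorm_mul_le`.

Necessity: two families of test functions are used. The indicator of B has norm at most C/φ(P(B)).
Its product with g vanishes on a sizable part of the parent of B, so oscillation controls the mean
of |g| on B (`exists_eLpNorm_cond_le`), and martingale convergence bounds g almost everywhere.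
Functions of bounded norm equal to φ_*(P(B)) on B (`exists_test_function`) force osc_B g ≤ C ‖g‖_Op
φ(P(B))/φ_*(P(B)). The integral condition enters in both constructions: it makes r^(1/p) φ(r) almost
increasing, with geometric decay along r/2^j, hence the Hardy-type bound `exists_hardy`.

That a multiplier is a bounded operator at all comes from the closed graph theorem
(`exists_isMultiplierBound`). -/

/-! ### Doubling weights and the growth of φ_* -/

theorem Doubling.exists_comparable {φ : ℝ → ℝ} (hd : Doubling φ)
    (hpos : ∀ r ∈ Ioc (0 : ℝ) 1, 0 < φ r) (R : ℝ) :
    ∃ K : ℝ, 1 ≤ K ∧ ∀ r ∈ Ioc (0 : ℝ) 1, ∀ s ∈ Ioc (0 : ℝ) 1, r ≤ s → s ≤ R * r →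
      φ r ≤ K * φ s ∧ φ s ≤ K * φ r := by
  obtain ⟨C, hC, h⟩ := hd
  have hC1 : 1 ≤ C := by
    have := (h 1 (by simp) 1 (by simp) (by norm_num) (by norm_num)).2
    rwa [div_self (hpos 1 (by simp)).ne'] at this
  have step : ∀ r ∈ Ioc (0 : ℝ) 1, ∀ s ∈ Ioc (0 : ℝ) 1, r ≤ s → s ≤ 2 * r →
      φ r ≤ C * φ s ∧ φ s ≤ C * φ r := by
    intro r hr s hs h1 h2
    have a := (h r hr s hs (by rw [div_le_div_iff₀ two_pos hs.1]; linarith)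
      (by rw [div_le_iff₀ hs.1]; linarith [hr.1])).2
    have b := (h s hs r hr (by rw [div_le_div_iff₀ two_pos hr.1]; linarith [hr.1])
      (by rw [div_le_iff₀ hr.1]; linarith)).2
    rw [div_le_iff₀ (hpos _ hs)] at a
    rw [div_le_iff₀ (hpos _ hr)] at b
    exact ⟨a, b⟩
  -- The larger point s is halved until it lies within a factor 2 of r; each halving costs one
  -- factor C.
  have main : ∀ N : ℕ, ∀ r ∈ Ioc (0 : ℝ) 1, ∀ s ∈ Ioc (0 : ℝ) 1, r ≤ s → s ≤ 2 ^ N * r →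
      φ r ≤ C ^ N * φ s ∧ φ s ≤ C ^ N * φ r := by
    intro N
    induction N with
    | zero =>
      intro r hr s hs h1 h2
      have : r = s := by apply le_antisymm h1; simpa using h2
      subst this
      simp
    | succ N ih =>
      intro r hr s hs h1 h2
      by_cases hc : s ≤ 2 * r
      · have hp := step r hr s hs h1 hc
        have h3 : C ≤ C ^ (N + 1) := le_self_pow₀ hC1 (by omega)
        exact ⟨hp.1.trans (mul_le_mul_of_nonneg_right h3 (hpos _ hs).le),
          hp.2.trans (mul_le_mul_of_nonneg_right h3 (hpos _ hr).le)⟩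
      · push Not at hc
        have hm : s / 2 ∈ Ioc (0 : ℝ) 1 := ⟨by linarith [hs.1], by linarith [hs.1, hs.2]⟩
        have h4 := step (s / 2) hm s hs (by linarith [hs.1]) (by linarith)
        have h5 := ih r hr (s / 2) hm (by linarith) (by rw [pow_succ] at h2; linarith)
        have h6 : 0 < C ^ N := by positivity
        constructor
        · calc φ r ≤ C ^ N * φ (s / 2) := h5.1
            _ ≤ C ^ N * (C * φ s) := mul_le_mul_of_nonneg_left h4.1 h6.le
            _ = _ := by ring
        · calc φ s ≤ C * φ (s / 2) := h4.2
            _ ≤ C * (C ^ N * φ r) := mul_le_mul_of_nonneg_left h5.2 hC.le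
            _ = _ := by ring
  obtain ⟨N, hN⟩ := pow_unbounded_of_one_lt R (by norm_num : (1 : ℝ) < 2)
  refine ⟨C ^ N, one_le_pow₀ hC1, fun r hr s hs h1 h2 => main N r hr s hs h1 (h2.trans ?_)⟩
  exact mul_le_mul_of_nonneg_right hN.le hr.1.le

section Analysis

variable {φ : ℝ → ℝ} (hpos : ∀ r ∈ Ioc (0 : ℝ) 1, 0 < φ r)
  (hmeas : AEMeasurable φ (volume.restrict (Ioc (0 : ℝ) 1))) (hd : Doubling φ)

include hpos hmeas hd

/-- Away from 0, doubling bounds φ by a multiple of φ(1), so measurability is enough. -/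
theorem intervalIntegrable_of_doubling {r s : ℝ} (hr : 0 < r) (hrs : r ≤ s) (hs : s ≤ 1) :
    IntervalIntegrable φ volume r s := by
  obtain ⟨K, hK, h⟩ := hd.exists_comparable hpos (1 / r)
  rw [intervalIntegrable_iff_integrableOn_Ioc_of_le hrs]
  have hsub : Ioc r s ⊆ Ioc 0 1 := Ioc_subset_Ioc hr.le hs
  refine IntegrableOn.of_bound (C := K * φ 1) measure_Ioc_lt_top
    (hmeas.mono_measure (Measure.restrict_mono hsub le_rfl)).aestronglyMeasurable ?_
  filter_upwards [ae_restrict_mem measurableSet_Ioc] with t ht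
  have ht' := hsub ht
  rw [Real.norm_of_nonneg (hpos _ ht').le]
  refine (h t ht' 1 (by simp) ht'.2 ?_).1
  rw [one_div, inv_mul_eq_div, one_le_div hr]
  exact ht.1.le

theorem intervalIntegrable_mul_rpow {r s : ℝ} (a : ℝ) (hr : 0 < r) (hrs : r ≤ s) (hs : s ≤ 1) :
    IntervalIntegrable (fun t => φ t * t ^ a) volume r s := by
  refine (intervalIntegrable_of_doubling hpos hmeas hd hr hrs hs).mul_continuousOn ?_
  rw [uIcc_of_le hrs]
  exact fun x hx => (Real.continuousAt_rpow_const _ _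
    (Or.inl (hr.trans_le hx.1).ne')).continuousWithinAt

theorem intervalIntegrable_div {r s : ℝ} (hr : 0 < r) (hrs : r ≤ s) (hs : s ≤ 1) :
    IntervalIntegrable (fun t => φ t / t) volume r s := by
  simpa [Real.rpow_neg_one, div_eq_mul_inv] using
    intervalIntegrable_mul_rpow hpos hmeas hd (-1) hr hrs hs

theorem lowerStar_sub {r s : ℝ} (hr : 0 < r) (hrs : r ≤ s) (hs : s ≤ 1) :
    lowerStar φ r - lowerStar φ s = ∫ t in r..s, φ t / t := by
  have := intervalIntegral.integral_add_adjacent_intervals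
    (intervalIntegrable_div hpos hmeas hd hr hrs hs)
    (intervalIntegrable_div hpos hmeas hd (hr.trans_le hrs) hs le_rfl)
  unfold lowerStar
  linarith

theorem lowerStar_anti {r s : ℝ} (hr : 0 < r) (hrs : r ≤ s) (hs : s ≤ 1) :
    lowerStar φ s ≤ lowerStar φ r := by
  have h := lowerStar_sub hpos hmeas hd hr hrs hs
  have : 0 ≤ ∫ t in r..s, φ t / t := by
    refine intervalIntegral.integral_nonneg hrs fun t ht => ?_
    have : t ∈ Ioc (0 : ℝ) 1 := ⟨hr.trans_le ht.1, ht.2.trans hs⟩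
    exact div_nonneg (hpos _ this).le this.1.le
  linarith

omit hpos hmeas hd in
theorem lowerStar_one : lowerStar φ 1 = 1 := by simp [lowerStar]

theorem one_le_lowerStar {r : ℝ} (hr : r ∈ Ioc (0 : ℝ) 1) : 1 ≤ lowerStar φ r := by
  simpa [lowerStar_one] using lowerStar_anti hpos hmeas hd hr.1 hr.2 le_rfl

/-- On [s, r] the weight is comparable to φ(r), and r - s is at least r/R, so the integral of φ(t)/t
over [s, r] is at least a fixed multiple of φ(r). Applied with r the measure of a parent and s that
of a strictly smaller child, it lets a sum of φ along a chain of atoms telescope into φ_*. -/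
theorem exists_le_lowerStar_sub {R : ℝ} (hR : 1 ≤ R) :
    ∃ K : ℝ, 1 ≤ K ∧ ∀ s ∈ Ioc (0 : ℝ) 1, ∀ r ∈ Ioc (0 : ℝ) 1, r ≤ R * s → r ≤ R * (r - s) →
      φ r ≤ K * (lowerStar φ s - lowerStar φ r) := by
  obtain ⟨K, hK, h⟩ := hd.exists_comparable hpos R
  refine ⟨K * R, one_le_mul_of_one_le_of_one_le hK hR, fun s hs r hr h1 h2 => ?_⟩
  have hR0 : 0 < R := by linarith
  have hsr : s ≤ r := by
    have : 0 ≤ r - s := by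
      by_contra hc
      push Not at hc
      nlinarith [hr.1]
    linarith
  rw [lowerStar_sub hpos hmeas hd hs.1 hsr hr.2]
  have key : ∫ _ in s..r, φ r / K / r ≤ ∫ t in s..r, φ t / t := by
    refine intervalIntegral.integral_mono_on hsr intervalIntegrable_const
      (intervalIntegrable_div hpos hmeas hd hs.1 hsr hr.2) fun t ht => ?_
    have ht' : t ∈ Ioc (0 : ℝ) 1 := ⟨hs.1.trans_le ht.1, ht.2.trans hr.2⟩
    have := (h t ht' r hr ht.2 (h1.trans (mul_le_mul_of_nonneg_left ht.1 hR0.le))).2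
    refine div_le_div₀ (hpos _ ht').le ?_ ht'.1 ht.2
    rw [div_le_iff₀ (by linarith)]
    linarith
  rw [intervalIntegral.integral_const, smul_eq_mul] at key
  have hφ := hpos r hr
  calc φ r = K * (φ r / K / r * r) := by field_simp [hr.1.ne']
    _ ≤ K * (φ r / K / r * (R * (r - s))) := by
        gcongr
        have := hr.1
        positivity
    _ = K * R * ((r - s) * (φ r / K / r)) := by ring
    _ ≤ _ := by gcongr

end Analysis

/-! ### Consequences of the integral condition -/

section Hardy

variable {φ : ℝ → ℝ} {p : ℝ}

/-- F(r) is the integral of φ^p over (0, r]. The integral condition bounds it above; by doubling, φ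
≥ φ(r)/K on (r/2, r], so this half alone contributes at least r φ(r)^p / (2 K^p). -/
theorem exists_integral_bounds (hp : 1 ≤ p) (hpos : ∀ r ∈ Ioc (0 : ℝ) 1, 0 < φ r)
    (hd : Doubling φ) (hint : IntegralCondition p φ) :
    ∃ (F : ℝ → ℝ) (c C : ℝ), 0 < c ∧ c ≤ C ∧
      (∀ s ∈ Ioc (0 : ℝ) 1, ∀ r ∈ Ioc (0 : ℝ) 1, s ≤ r → F s ≤ F r) ∧
      (∀ r ∈ Ioc (0 : ℝ) 1, F r ≤ C * (r * φ r ^ p)) ∧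
      (∀ r ∈ Ioc (0 : ℝ) 1, 0 ≤ F (r / 2)) ∧
      ∀ r ∈ Ioc (0 : ℝ) 1, F (r / 2) + c * (r * φ r ^ p) ≤ F r := by
  obtain ⟨C, hC, h⟩ := hint
  obtain ⟨K, hK, hcomp⟩ := hd.exists_comparable hpos 2
  have hfin : ∀ r ∈ Ioc (0 : ℝ) 1, ∫⁻ t in Ioc 0 r, ENNReal.ofReal (φ t ^ p) ≠ ∞ := fun r hr =>
    ((h r hr).trans_lt ENNReal.ofReal_lt_top).ne
  have hK0 : 0 < K := by linarith
  have hup : ∀ r ∈ Ioc (0 : ℝ) 1,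
      (∫⁻ t in Ioc 0 r, ENNReal.ofReal (φ t ^ p)).toReal ≤ C * (r * φ r ^ p) := by
    intro r hr
    have h0 : 0 ≤ C * (r * φ r ^ p) :=
      mul_nonneg hC.le (mul_nonneg hr.1.le (Real.rpow_nonneg (hpos r hr).le _))
    refine ENNReal.toReal_le_of_le_ofReal h0 ((h r hr).trans_eq ?_)
    ring_nf
  have hlow : ∀ r ∈ Ioc (0 : ℝ) 1,
      (∫⁻ t in Ioc 0 (r / 2), ENNReal.ofReal (φ t ^ p)).toReal
        + (2 * K ^ p)⁻¹ * (r * φ r ^ p) ≤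
      (∫⁻ t in Ioc 0 r, ENNReal.ofReal (φ t ^ p)).toReal := by
    intro r hr
    have hr2 : r / 2 ∈ Ioc (0 : ℝ) 1 := ⟨by linarith [hr.1], by linarith [hr.1, hr.2]⟩
    have hφ := hpos r hr
    have hu : Ioc 0 r = Ioc 0 (r / 2) ∪ Ioc (r / 2) r :=
      (Ioc_union_Ioc_eq_Ioc hr2.1.le (by linarith [hr.1])).symm
    have hdj : Disjoint (Ioc 0 (r / 2)) (Ioc (r / 2) r) := by
      rw [Set.disjoint_left]
      intro x hx hx'
      exact absurd hx'.1 (not_lt.2 hx.2)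
    have hl : ENNReal.ofReal ((2 * K ^ p)⁻¹ * (r * φ r ^ p)) ≤
        ∫⁻ t in Ioc (r / 2) r, ENNReal.ofReal (φ t ^ p) := by
      have e : ENNReal.ofReal ((2 * K ^ p)⁻¹ * (r * φ r ^ p)) =
          ∫⁻ _ in Ioc (r / 2) r, ENNReal.ofReal ((φ r / K) ^ p) := by
        rw [setLIntegral_const, Real.volume_Ioc, ← ENNReal.ofReal_mul (by positivity)]
        congr 1
        rw [Real.div_rpow hφ.le hK0.le]
        field_simp
        ring
      rw [e]
      refine setLIntegral_mono' measurableSet_Ioc fun t ht => ?_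
      have ht' : t ∈ Ioc (0 : ℝ) 1 := ⟨hr2.1.trans ht.1, ht.2.trans hr.2⟩
      refine ENNReal.ofReal_le_ofReal (Real.rpow_le_rpow (by positivity) ?_ (by linarith))
      rw [div_le_iff₀ hK0, mul_comm]
      exact (hcomp t ht' r hr ht.2 (by linarith [ht.1])).2
    have hsplit := lintegral_union (μ := volume) (f := fun t => ENNReal.ofReal (φ t ^ p))
      (measurableSet_Ioc (a := r / 2) (b := r)) hdj
    rw [← hu] at hsplit
    have hfin2 := hfin r hr
    rw [hsplit] at hfin2 ⊢
    rw [ENNReal.toReal_add (ENNReal.add_ne_top.1 hfin2).1 (ENNReal.add_ne_top.1 hfin2).2]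
    gcongr
    exact (ENNReal.ofReal_le_iff_le_toReal (ENNReal.add_ne_top.1 hfin2).2).1 hl
  refine ⟨fun r => (∫⁻ t in Ioc 0 r, ENNReal.ofReal (φ t ^ p)).toReal, (2 * K ^ p)⁻¹, C,
    by positivity, ?_, ?_, hup, fun _ _ => ENNReal.toReal_nonneg, hlow⟩
  -- The inequality c ≤ C follows by comparing the two bounds at r = 1.
  · have h1 := hlow 1 (by simp)
    have h2 := hup 1 (by simp)
    have h3 : 0 < 1 * φ 1 ^ p := by
      have := hpos 1 (by simp)
      positivity
    have h4 := ENNReal.toReal_nonneg (a := ∫⁻ t in Ioc 0 (1 / 2), ENNReal.ofReal (φ t ^ p))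
    exact le_of_mul_le_mul_right (by linarith) h3
  · intro s hs r hr hsr
    exact ENNReal.toReal_mono (hfin r hr) (lintegral_mono_set (Ioc_subset_Ioc_right hsr))

/-- The bounds on F give F(r/2) ≤ (1 - c/C) F(r), so F decays geometrically along r/2^j. Since F(r)
is comparable to r φ(r)^p, taking p-th roots transfers monotonicity and decay, up to a constant, to
r^(1/p) φ(r). -/
theorem exists_geometric_decay (hp : 1 ≤ p) (hpos : ∀ r ∈ Ioc (0 : ℝ) 1, 0 < φ r)
    (hd : Doubling φ) (hint : IntegralCondition p φ) :
    ∃ (K δ : ℝ), 1 ≤ K ∧ 0 ≤ δ ∧ δ < 1 ∧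
      (∀ s ∈ Ioc (0 : ℝ) 1, ∀ r ∈ Ioc (0 : ℝ) 1, s ≤ r →
        s ^ (1 / p) * φ s ≤ K * (r ^ (1 / p) * φ r)) ∧
      ∀ r ∈ Ioc (0 : ℝ) 1, ∀ j : ℕ,
        (r / 2 ^ j) ^ (1 / p) * φ (r / 2 ^ j) ≤ K * δ ^ j * (r ^ (1 / p) * φ r) := by
  obtain ⟨F, c, C, hc, hcC, hmono, hup, hnn, hlow⟩ := exists_integral_bounds hp hpos hd hint
  have hp0 : 0 < p := by linarith
  have hC : 0 < C := by linarith
  have hlow' : ∀ r ∈ Ioc (0 : ℝ) 1, c * (r * φ r ^ p) ≤ F r := fun r hr => by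
    linarith [hlow r hr, hnn r hr]
  have half : ∀ r ∈ Ioc (0 : ℝ) 1, F (r / 2) ≤ (1 - c / C) * F r := by
    intro r hr
    have h1 := hup r hr
    have h2 := hlow r hr
    have h3 : c / C * F r ≤ c * (r * φ r ^ p) := by
      calc c / C * F r ≤ c / C * (C * (r * φ r ^ p)) := by gcongr
        _ = _ := by field_simp
    linarith
  have hδ0 : 0 ≤ 1 - c / C := by
    rw [sub_nonneg, div_le_one hC]
    exact hcC
  have hδ1 : 1 - c / C < 1 := by
    have : 0 < c / C := by positivity
    linarith
  have hmem : ∀ r ∈ Ioc (0 : ℝ) 1, ∀ j : ℕ, r / 2 ^ j ∈ Ioc (0 : ℝ) 1 := fun r hr j =>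
    ⟨div_pos hr.1 (by positivity), (div_le_self hr.1.le (one_le_pow₀ one_le_two)).trans hr.2⟩
  have iter : ∀ r ∈ Ioc (0 : ℝ) 1, ∀ j : ℕ, F (r / 2 ^ j) ≤ (1 - c / C) ^ j * F r := by
    intro r hr j
    induction j with
    | zero => simp
    | succ j ih =>
      have := half _ (hmem r hr j)
      rw [div_div, ← pow_succ] at this
      calc _ ≤ _ := this
        _ ≤ (1 - c / C) * ((1 - c / C) ^ j * F r) := by gcongr
        _ = _ := by ring
  have root : ∀ s ∈ Ioc (0 : ℝ) 1, ∀ r ∈ Ioc (0 : ℝ) 1, ∀ a : ℝ, 0 ≤ a →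
      s * φ s ^ p ≤ a * (r * φ r ^ p) →
      s ^ (1 / p) * φ s ≤ a ^ (1 / p) * (r ^ (1 / p) * φ r) := by
    intro s hs r hr a ha h
    have e : ∀ t ∈ Ioc (0 : ℝ) 1, (t * φ t ^ p) ^ (1 / p) = t ^ (1 / p) * φ t := by
      intro t ht
      rw [Real.mul_rpow ht.1.le (Real.rpow_nonneg (hpos t ht).le _),
        ← Real.rpow_mul (hpos t ht).le, mul_one_div_cancel hp0.ne', Real.rpow_one]
    have hr0 : 0 ≤ r * φ r ^ p := mul_nonneg hr.1.le (Real.rpow_nonneg (hpos r hr).le _)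
    have h2 := Real.rpow_le_rpow (mul_nonneg hs.1.le (Real.rpow_nonneg (hpos s hs).le _)) h
      (by positivity : 0 ≤ 1 / p)
    rwa [Real.mul_rpow ha hr0, e s hs, e r hr] at h2
  have hK : 1 ≤ C / c := (one_le_div hc).2 hcC
  have hpow : ∀ x : ℝ, ∀ j : ℕ, 0 ≤ x → (x ^ j) ^ (1 / p) = (x ^ (1 / p)) ^ j := by
    intro x j hx
    rw [← Real.rpow_natCast, ← Real.rpow_natCast, ← Real.rpow_mul hx, ← Real.rpow_mul hx, mul_comm]
  refine ⟨(C / c) ^ (1 / p), (1 - c / C) ^ (1 / p), Real.one_le_rpow hK (by positivity),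
    Real.rpow_nonneg hδ0 _, Real.rpow_lt_one hδ0 hδ1 (by positivity), ?_, ?_⟩
  · intro s hs r hr hsr
    refine root s hs r hr _ (by positivity) ?_
    have := (hlow' s hs).trans ((hmono s hs r hr hsr).trans (hup r hr))
    rw [div_mul_eq_mul_div, le_div_iff₀ hc]
    linarith
  · intro r hr j
    rw [← hpow _ _ hδ0, ← Real.mul_rpow (by positivity) (by positivity)]
    refine root _ (hmem r hr j) r hr _ (by positivity) ?_
    have h1 := hlow' _ (hmem r hr j)
    have h2 := iter r hr j
    have h3 : (1 - c / C) ^ j * F r ≤ (1 - c / C) ^ j * (C * (r * φ r ^ p)) :=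
      mul_le_mul_of_nonneg_left (hup r hr) (by positivity)
    refine le_of_mul_le_mul_left ((h1.trans (h2.trans h3)).trans_eq ?_) hc
    field_simp

/-- The integral over each dyadic piece [ρ/2, ρ] is at most a multiple of ρ^(1/p) φ(ρ), and these
values at ρ = r/2^j are dominated by a geometric series. -/
theorem exists_hardy (hp : 1 ≤ p) (hpos : ∀ r ∈ Ioc (0 : ℝ) 1, 0 < φ r)
    (hmeas : AEMeasurable φ (volume.restrict (Ioc (0 : ℝ) 1)))
    (hd : Doubling φ) (hint : IntegralCondition p φ) :
    ∃ K : ℝ, 1 ≤ K ∧ ∀ s ∈ Ioc (0 : ℝ) 1, ∀ r ∈ Ioc (0 : ℝ) 1, s ≤ r →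
      ∫ t in s..r, φ t * t ^ (1 / p - 1) ≤ K * (r ^ (1 / p) * φ r) := by
  obtain ⟨K, δ, hK, hδ0, hδ1, -, hdec⟩ := exists_geometric_decay hp hpos hd hint
  obtain ⟨D, hD, hcomp⟩ := hd.exists_comparable hpos 2
  have hp0 : 0 < p := by linarith
  have hD0 : 0 < D := by linarith
  have hK0 : 0 < K := by linarith
  have hnn : ∀ t ∈ Ioc (0 : ℝ) 1, 0 ≤ φ t * t ^ (1 / p - 1) := fun t ht =>
    mul_nonneg (hpos t ht).le (Real.rpow_nonneg ht.1.le _)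
  have hone : 1 / p - 1 ≤ 0 := by
    rw [sub_nonpos, div_le_one hp0]
    exact hp
  have piece : ∀ r ∈ Ioc (0 : ℝ) 1,
      ∫ t in r / 2..r, φ t * t ^ (1 / p - 1) ≤ D * (r ^ (1 / p) * φ r) := by
    intro r hr
    have hr2 : 0 < r / 2 := by linarith [hr.1]
    have hle : r / 2 ≤ r := by linarith
    have h1 : ∫ t in r / 2..r, φ t * t ^ (1 / p - 1) ≤
        ∫ _ in r / 2..r, D * φ r * (r / 2) ^ (1 / p - 1) := by
      refine intervalIntegral.integral_mono_on hle
        (intervalIntegrable_mul_rpow hpos hmeas hd _ hr2 hle hr.2)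
        intervalIntegrable_const fun t ht => ?_
      have ht' : t ∈ Ioc (0 : ℝ) 1 := ⟨hr2.trans_le ht.1, ht.2.trans hr.2⟩
      have h2 := (hcomp t ht' r hr ht.2 (by linarith [ht.1])).1
      exact mul_le_mul h2 (Real.rpow_le_rpow_of_nonpos hr2 ht.1 hone)
        (Real.rpow_nonneg ht'.1.le _) (mul_nonneg hD0.le (hpos r hr).le)
    rw [intervalIntegral.integral_const, smul_eq_mul] at h1
    refine h1.trans ?_
    have h3 : (r - r / 2) * (r / 2) ^ (1 / p - 1) = (r / 2) ^ (1 / p) := by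
      rw [Real.rpow_sub_one hr2.ne', show r - r / 2 = r / 2 by ring, mul_div_cancel₀ _ hr2.ne']
    have h4 : (r / 2) ^ (1 / p) ≤ r ^ (1 / p) :=
      Real.rpow_le_rpow hr2.le hle (by positivity)
    have hφ := hpos r hr
    calc _ = D * ((r - r / 2) * (r / 2) ^ (1 / p - 1) * φ r) := by ring
      _ ≤ _ := by
        rw [h3]
        gcongr
  have hmem : ∀ r ∈ Ioc (0 : ℝ) 1, ∀ j : ℕ, r / 2 ^ j ∈ Ioc (0 : ℝ) 1 := fun r hr j =>
    ⟨div_pos hr.1 (by positivity), (div_le_self hr.1.le (one_le_pow₀ one_le_two)).trans hr.2⟩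
  have dyadic : ∀ r ∈ Ioc (0 : ℝ) 1, ∀ N : ℕ,
      ∫ t in r / 2 ^ N..r, φ t * t ^ (1 / p - 1) ≤
        D * (K * (r ^ (1 / p) * φ r)) * ∑ j ∈ Finset.range N, δ ^ j := by
    intro r hr N
    induction N with
    | zero => simp
    | succ N ih =>
      have hm := hmem r hr N
      have hm1 := hmem r hr (N + 1)
      have e : r / 2 ^ (N + 1) = r / 2 ^ N / 2 := by rw [div_div, ← pow_succ]
      have hle : r / 2 ^ (N + 1) ≤ r / 2 ^ N := by
        rw [e]
        linarith [hm.1]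
      have hle2 : r / 2 ^ N ≤ r := div_le_self hr.1.le (one_le_pow₀ one_le_two)
      rw [← intervalIntegral.integral_add_adjacent_intervals
        (intervalIntegrable_mul_rpow hpos hmeas hd _ hm1.1 hle hm.2)
        (intervalIntegrable_mul_rpow hpos hmeas hd _ hm.1 hle2 hr.2), Finset.sum_range_succ, mul_add]
      have h1 := piece _ hm
      rw [← e] at h1
      have h2 := mul_le_mul_of_nonneg_left (hdec r hr N) hD0.le
      linarith
  refine ⟨D * K * (1 - δ)⁻¹, ?_, ?_⟩
  · have : 1 ≤ (1 - δ)⁻¹ := (one_le_inv₀ (by linarith)).2 (by linarith)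
    exact one_le_mul_of_one_le_of_one_le (one_le_mul_of_one_le_of_one_le hD hK) this
  · intro s hs r hr hsr
    obtain ⟨N, hN⟩ := pow_unbounded_of_one_lt (r / s) (by norm_num : (1 : ℝ) < 2)
    have hm := hmem r hr N
    have hNs : r / 2 ^ N ≤ s := by
      rw [div_lt_iff₀ hs.1] at hN
      rw [div_le_iff₀ (by positivity)]
      linarith
    have h1 : ∫ t in s..r, φ t * t ^ (1 / p - 1) ≤
        ∫ t in r / 2 ^ N..r, φ t * t ^ (1 / p - 1) := by
      rw [← intervalIntegral.integral_add_adjacent_intervals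
        (intervalIntegrable_mul_rpow hpos hmeas hd _ hm.1 hNs hs.2)
        (intervalIntegrable_mul_rpow hpos hmeas hd _ hs.1 hsr hr.2)]
      have : 0 ≤ ∫ t in r / 2 ^ N..s, φ t * t ^ (1 / p - 1) :=
        intervalIntegral.integral_nonneg hNs fun t ht =>
          hnn t ⟨hm.1.trans_le ht.1, ht.2.trans hs.2⟩
      linarith
    refine h1.trans ((dyadic r hr N).trans ?_)
    have h2 : ∑ j ∈ Finset.range N, δ ^ j ≤ (1 - δ)⁻¹ := by
      have := (summable_geometric_of_lt_one hδ0 hδ1).sum_le_tsum (Finset.range N)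
        (fun _ _ => by positivity)
      rwa [tsum_geometric_of_lt_one hδ0 hδ1] at this
    have hφ := hpos r hr
    have hrr := hr.1
    calc _ ≤ D * (K * (r ^ (1 / p) * φ r)) * (1 - δ)⁻¹ := by gcongr
      _ = _ := by ring

end Hardy

open ProbabilityTheory

/-! ### Mean oscillation with respect to a probability measure -/

section MeanOscillation

variable {Ω : Type*} {m0 : MeasurableSpace Ω} {𝕜 : Type*} [RCLike 𝕜]

/-- The mean oscillation `‖f - ∫ f dν‖_{L^q(ν)}`. -/
noncomputable def meanOscillation (q : ℝ≥0∞) (ν : Measure Ω) (f : Ω → 𝕜) : ℝ≥0∞ :=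
  eLpNorm (fun ω => f ω - ∫ x, f x ∂ν) q ν

variable {ν : Measure Ω} {q : ℝ≥0∞} {f g : Ω → 𝕜}

theorem meanOscillation_congr (h : f =ᵐ[ν] g) : meanOscillation q ν f = meanOscillation q ν g := by
  unfold meanOscillation
  rw [integral_congr_ae h]
  exact eLpNorm_congr_ae (h.mono fun ω hω => by simp [hω])

variable [IsProbabilityMeasure ν]

theorem enorm_integral_sub_const_le (hf : Integrable f ν) (c : 𝕜) :
    ‖(∫ x, f x ∂ν) - c‖ₑ ≤ eLpNorm (fun ω => f ω - c) 1 ν := by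
  have : (∫ x, f x ∂ν) - c = ∫ x, (f x - c) ∂ν := by
    rw [integral_sub hf (integrable_const c)]
    simp
  rw [this, eLpNorm_one_eq_lintegral_enorm]
  exact enorm_integral_le_lintegral_enorm _

/-- Replacing the mean by c shifts by mean - c, whose modulus is at most the L^1 norm, hence the L^q
norm, of f - c. Oscillations can thus be estimated with a convenient constant. -/
theorem meanOscillation_le_two_mul (hq : 1 ≤ q) (hf : Integrable f ν) (c : 𝕜) :
    meanOscillation q ν f ≤ 2 * eLpNorm (fun ω => f ω - c) q ν := by
  have hm : AEStronglyMeasurable (fun ω => f ω - c) ν :=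
    hf.aestronglyMeasurable.sub aestronglyMeasurable_const
  have e : (fun ω => f ω - ∫ x, f x ∂ν) =
      (fun ω => f ω - c) - fun _ => ((∫ x, f x ∂ν) - c) := by
    ext ω
    simp
  unfold meanOscillation
  rw [e, two_mul]
  refine (eLpNorm_sub_le hm aestronglyMeasurable_const hq).trans ?_
  gcongr
  rw [eLpNorm_const _ (by positivity) (NeZero.ne ν)]
  simp only [measure_univ, ENNReal.one_rpow, mul_one]
  exact (enorm_integral_sub_const_le hf c).trans (eLpNorm_le_eLpNorm_of_exponent_le hq hm)

omit [IsProbabilityMeasure ν] in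
theorem meanOscillation_add_le (hq : 1 ≤ q) (hf : Integrable f ν) (hg : Integrable g ν) :
    meanOscillation q ν (f + g) ≤ meanOscillation q ν f + meanOscillation q ν g := by
  unfold meanOscillation
  refine le_trans (le_of_eq ?_) (eLpNorm_add_le (hf.aestronglyMeasurable.sub
    aestronglyMeasurable_const) (hg.aestronglyMeasurable.sub aestronglyMeasurable_const) hq)
  congr 1
  ext ω
  simp only [Pi.add_apply]
  rw [integral_add hf hg]
  ring

omit [IsProbabilityMeasure ν] in
theorem meanOscillation_const_mul (c : 𝕜) (f : Ω → 𝕜) :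
    meanOscillation q ν (fun ω => c * f ω) = ‖c‖ₑ * meanOscillation q ν f := by
  unfold meanOscillation
  rw [← eLpNorm_const_smul]
  congr 1
  ext ω
  rw [integral_const_mul]
  simp [mul_sub]

theorem eLpNorm_le_meanOscillation_add (hq : 1 ≤ q) (hf : AEStronglyMeasurable f ν) :
    eLpNorm f q ν ≤ meanOscillation q ν f + ‖∫ x, f x ∂ν‖ₑ := by
  have e : f = (fun ω => f ω - ∫ x, f x ∂ν) + fun _ => ∫ x, f x ∂ν := by
    ext ω
    simp
  refine (congrArg (eLpNorm · q ν) e).trans_le <|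
    (eLpNorm_add_le (hf.sub aestronglyMeasurable_const) aestronglyMeasurable_const hq).trans ?_
  rw [eLpNorm_const _ (by positivity) (NeZero.ne ν)]
  simp only [measure_univ, ENNReal.one_rpow, mul_one]
  exact le_rfl

omit [IsProbabilityMeasure ν] in
theorem meanOscillation_le_liminf {u : ℕ → Ω → 𝕜} (hu : ∀ k, AEStronglyMeasurable (u k) ν)
    (hlim : ∀ᵐ ω ∂ν, Filter.Tendsto (fun k => u k ω) Filter.atTop (nhds (f ω)))
    (hint : Filter.Tendsto (fun k => ∫ x, u k x ∂ν) Filter.atTop (nhds (∫ x, f x ∂ν))) :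
    meanOscillation q ν f ≤ Filter.liminf (fun k => meanOscillation q ν (u k)) Filter.atTop := by
  refine Lp.eLpNorm_lim_le_liminf_eLpNorm
    (fun k => (hu k).sub aestronglyMeasurable_const) _ ?_
  filter_upwards [hlim] with ω hω
  exact hω.sub hint

end MeanOscillation

/-! ### Atoms and conditional expectations on them -/

section Atoms

variable {Ω : Type*} {m0 : MeasurableSpace Ω} {P : Measure Ω}

theorem ae_cond_iff_ae [IsFiniteMeasure P] {B : Set Ω} (hB : MeasurableSet B) {s : Ω → Prop} :
    (∀ᵐ ω ∂P[|B], s ω) ↔ ∀ᵐ ω ∂P, ω ∈ B → s ω := by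
  have h0 : (P B)⁻¹ ≠ 0 := ENNReal.inv_ne_zero.2 (measure_ne_top P B)
  rw [ProbabilityTheory.cond, Measure.ae_ennreal_smul_measure_iff h0, ae_restrict_iff' hB]

theorem cond_congr {A B : Set Ω} (h : A =ᵐ[P] B) : P[|A] = P[|B] := by
  unfold ProbabilityTheory.cond
  rw [measure_congr h, Measure.restrict_congr_set h]

variable [IsProbabilityMeasure P] {𝕜 : Type*} [RCLike 𝕜] {m : MeasurableSpace Ω} {B : Set Ω}

omit [IsProbabilityMeasure P] in
theorem integrable_cond {f : Ω → 𝕜} (hf : Integrable f P) (hB : 0 < P B) :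
    Integrable f P[|B] :=
  hf.restrict.smul_measure (ENNReal.inv_ne_top.2 hB.ne')

theorem measureReal_mem_Ioc (hB : 0 < P B) : P.real B ∈ Ioc (0 : ℝ) 1 :=
  ⟨ENNReal.toReal_pos hB.ne' (measure_ne_top P B), measureReal_le_one⟩

omit [IsProbabilityMeasure P] in
theorem IsMeasureAtom.measure_inter_eq_zero_or (hB : IsMeasureAtom P m B) (hm : m ≤ m0) {A : Set Ω}
    [IsFiniteMeasure P] (hA : MeasurableSet[m] A) : P (B ∩ A) = 0 ∨ P (B \ A) = 0 := by
  rcases hB.2 (B ∩ A) inter_subset_left (MeasurableSet.inter hB.1 hA) with h | h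
  · right
    have := measure_inter_add_sdiff (μ := P) B (hm _ hA)
    rw [h] at this
    exact (ENNReal.add_right_inj (measure_ne_top P B)).1 (this.trans (add_zero _).symm)
  · exact Or.inl h

/-- Each measurable preimage has null or full measure in B, and countably many measurable sets
separate the points of 𝕜. -/
theorem IsMeasureAtom.exists_ae_eq_const (hB : IsMeasureAtom P m B) (hm : m ≤ m0)
    {f : Ω → 𝕜} (hf : StronglyMeasurable[m] f) : ∃ c : 𝕜, ∀ᵐ ω ∂P[|B], f ω = c := by
  refine Filter.exists_eventuallyEq_const_of_forall_separating MeasurableSet fun U hU => ?_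
  have hBm := hm _ hB.1
  rw [ae_cond_iff_ae hBm, ae_cond_iff_ae hBm]
  rcases hB.measure_inter_eq_zero_or hm (hf.measurable hU) with h | h
  · right
    filter_upwards [measure_eq_zero_iff_ae_notMem.1 h] with ω hω hωB hωU
    exact hω ⟨hωB, hωU⟩
  · left
    filter_upwards [measure_eq_zero_iff_ae_notMem.1 h] with ω hω hωB
    by_contra hωU
    exact hω ⟨hωB, hωU⟩

omit [IsProbabilityMeasure P] in
theorem integral_cond (f : Ω → 𝕜) : ∫ ω, f ω ∂P[|B] = (P.real B)⁻¹ • ∫ ω in B, f ω ∂P := by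
  rw [ProbabilityTheory.cond, integral_smul_measure, ENNReal.toReal_inv]
  rfl

theorem IsMeasureAtom.condExp_ae_eq (hB : IsMeasureAtom P m B) (hm : m ≤ m0) (h0 : 0 < P B)
    {f : Ω → 𝕜} (hf : Integrable f P) :
    ∀ᵐ ω ∂P[|B], (P[f | m]) ω = ∫ x, f x ∂P[|B] := by
  obtain ⟨c, hc⟩ := hB.exists_ae_eq_const hm (stronglyMeasurable_condExp (μ := P) (f := f))
  have : IsProbabilityMeasure P[|B] := cond_isProbabilityMeasure h0.ne'
  have h1 : ∫ x, (P[f | m]) x ∂P[|B] = ∫ x, f x ∂P[|B] := by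
    rw [integral_cond, integral_cond, setIntegral_condExp hm hf hB.1]
  have h2 : ∫ x, (P[f | m]) x ∂P[|B] = c := by
    rw [integral_congr_ae hc]
    simp
  filter_upwards [hc] with ω hω
  rw [hω, ← h1, h2]

omit [IsProbabilityMeasure P] in
-- The generators of positive measure need not cover Ω, but if the uncovered part U is not null it
-- is itself an atom: each generator is null or disjoint from U, and the sets that are null or
-- conull in U are stable under complements and countable unions.
theorem exists_countable_atoms [IsFiniteMeasure P] (hm : m ≤ m0)
    (hg : GeneratedByCountableAtoms P m) :
    ∃ T : Set (Set Ω), T.Countable ∧ (∀ B ∈ T, IsMeasureAtom P m B ∧ 0 < P B) ∧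
      P (⋃₀ T)ᶜ = 0 := by
  obtain ⟨S, hS, hatom, hgen⟩ := hg
  set T := {B ∈ S | 0 < P B} with hT
  have hTc : T.Countable := hS.mono (sep_subset _ _)
  have hTm : MeasurableSet[m] (⋃₀ T) := MeasurableSet.sUnion hTc fun B hB => (hatom B hB.1).1
  set U := (⋃₀ T)ᶜ with hU
  by_cases h0 : P U = 0
  · exact ⟨T, hTc, fun B hB => ⟨hatom B hB.1, hB.2⟩, h0⟩
  have key : ∀ A, MeasurableSet[m] A → P (U ∩ A) = 0 ∨ P (U \ A) = 0 := by
    intro A hA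
    rw [hgen] at hA
    induction A, hA using MeasurableSpace.generateFrom_induction with
    | hC t ht _ =>
      left
      by_cases h : 0 < P t
      · have : U ∩ t = ∅ := by
          rw [← disjoint_iff_inter_eq_empty, hU, disjoint_compl_left_iff_subset]
          exact subset_sUnion_of_mem ⟨ht, h⟩
        simp [this]
      · exact measure_mono_null inter_subset_right (by simpa using h)
    | empty => simp
    | compl t _ ih =>
      rw [sdiff_compl, ← sdiff_eq]
      exact ih.symm
    | iUnion s _ ih =>
      by_cases h : ∀ n, P (U ∩ s n) = 0
      · left
        rw [inter_iUnion]
        exact measure_iUnion_null h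
      · right
        push Not at h
        obtain ⟨n, hn⟩ := h
        exact measure_mono_null (sdiff_subset_sdiff_right (subset_iUnion s n))
          ((ih n).resolve_left hn)
  have hUatom : IsMeasureAtom P m U := by
    refine ⟨hTm.compl, fun A hAU hA => ?_⟩
    rcases key A hA with h | h
    · right
      rwa [inter_eq_right.2 hAU] at h
    · left
      have := measure_inter_add_sdiff (μ := P) U (hm _ hA)
      rw [h, inter_eq_right.2 hAU] at this
      simpa using this
  refine ⟨insert U T, hTc.insert U, ?_, ?_⟩
  · rintro B (rfl | hB)
    · exact ⟨hUatom, pos_iff_ne_zero.2 h0⟩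
    · exact ⟨hatom B hB.1, hB.2⟩
  · rw [sUnion_insert, hU, compl_union, compl_compl]
    simp

theorem exists_atom_inter_pos (hm : m ≤ m0) (hg : GeneratedByCountableAtoms P m) {A : Set Ω}
    (hA : 0 < P A) : ∃ B, IsMeasureAtom P m B ∧ 0 < P (A ∩ B) := by
  obtain ⟨T, hTc, hT, hT0⟩ := exists_countable_atoms hm hg
  by_contra! h
  refine hA.ne' (measure_mono_null (t := (⋃ B ∈ T, A ∩ B) ∪ (⋃₀ T)ᶜ) ?_ ?_)
  · intro ω hω
    by_cases hωT : ω ∈ ⋃₀ T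
    · obtain ⟨B, hB, hωB⟩ := hωT
      exact Or.inl (mem_biUnion hB ⟨hω, hωB⟩)
    · exact Or.inr hωT
  · refine measure_union_null ((measure_biUnion_null_iff hTc).2 fun B hB => ?_) hT0
    simpa using h B (hT B hB).1

end Atoms

/-! ### Regularity as a bound on the ratio of parent to child -/

section Regular

variable {Ω : Type*} {m0 : MeasurableSpace Ω}

/-- The properties of an atomic regular filtration with trivial `ℱ 0` that are used below. -/
structure IsRegularAtomic (P : Measure Ω) (ℱ : Filtration ℕ m0) (R : ℝ) : Prop where
  two_le : 2 ≤ R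
  bot : ℱ 0 = ⊥
  exists_atom : ∀ n (A : Set Ω), 0 < P A → ∃ B, IsMeasureAtom P (ℱ n) B ∧ 0 < P (A ∩ B)
  measureReal_le : ∀ n (A B : Set Ω), IsMeasureAtom P (ℱ n) B → MeasurableSet[ℱ (n + 1)] A →
    0 < P A → P (A \ B) = 0 → P.real B ≤ R * P.real A

/-- Regularity is applied to the martingale of conditional expectations of the indicator of A. At
time n + 1 it equals 1 on A, and at time n it equals P(A)/P(B) on B, whence 1 ≤ R P(A)/P(B). -/
theorem IsRegular.exists_isRegularAtomic {P : Measure Ω} [IsProbabilityMeasure P]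
    {ℱ : Filtration ℕ m0} (hreg : IsRegular P ℱ)
    (hatoms : ∀ n, GeneratedByCountableAtoms P (ℱ n)) (hzero : ℱ 0 = ⊥) :
    ∃ R, IsRegularAtomic P ℱ R := by
  obtain ⟨R, hR, h⟩ := hreg
  refine ⟨R, hR, hzero, fun n A hA => exists_atom_inter_pos (ℱ.le n) (hatoms n) hA, ?_⟩
  intro n A B hB hA hA0 hAB
  have hAm := ℱ.le _ _ hA
  have hBm := ℱ.le _ _ hB.1
  have hAint : Integrable (A.indicator fun _ => (1 : ℝ)) P :=
    (integrable_const 1).indicator hAm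
  have hinter : P (A ∩ B) = P A := by
    rw [← measure_inter_add_sdiff A hBm, hAB, add_zero]
  have hB0 : 0 < P B := hA0.trans_le (hinter ▸ measure_mono inter_subset_right)
  have hmart := h _ (martingale_condExp (A.indicator fun _ => (1 : ℝ)) ℱ P)
    (fun k => condExp_nonneg (Filter.Eventually.of_forall fun ω =>
      indicator_nonneg (fun _ _ => zero_le_one) ω)) n
  have hn := hB.condExp_ae_eq (ℱ.le n) hB0 hAint
  rw [ae_cond_iff_ae hBm] at hn
  have hn1 : P[A.indicator fun _ => (1 : ℝ) | ℱ (n + 1)] = A.indicator fun _ => (1 : ℝ) :=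
    condExp_of_stronglyMeasurable (ℱ.le _) (stronglyMeasurable_const.indicator hA) hAint
  have hval : ∫ x, A.indicator (fun _ => (1 : ℝ)) x ∂P[|B] = (P.real B)⁻¹ * P.real A := by
    rw [integral_cond, integral_indicator_const _ hAm, measureReal_restrict_apply hAm,
      Measure.real, Measure.real, Measure.real, hinter]
    simp
  have hBpos := (measureReal_mem_Ioc hB0).1
  by_contra hlt
  push Not at hlt
  refine hA0.ne' (hinter ▸ measure_eq_zero_iff_ae_notMem.2 ?_)
  filter_upwards [hmart, hn] with ω h1 h2 hω
  rw [h2 hω.2, hn1, hval, indicator_of_mem hω.1] at h1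
  rw [← mul_assoc, mul_comm R, mul_assoc, inv_mul_eq_div, le_div_iff₀ hBpos] at h1
  linarith

variable {P : Measure Ω} [IsProbabilityMeasure P] {ℱ : Filtration ℕ m0} {R : ℝ}
  (hF : IsRegularAtomic P ℱ R)

include hF

theorem IsRegularAtomic.isMeasureAtom_univ : IsMeasureAtom P (ℱ 0) univ := by
  refine ⟨MeasurableSet.univ, fun A _ hA => ?_⟩
  rw [hF.bot, MeasurableSpace.measurableSet_bot_iff] at hA
  rcases hA with rfl | rfl <;> simp

omit [IsProbabilityMeasure P] in
theorem IsRegularAtomic.eq_univ {B : Set Ω} (hB : IsMeasureAtom P (ℱ 0) B) (h0 : 0 < P B) :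
    B = univ := by
  have := hB.1
  rw [hF.bot, MeasurableSpace.measurableSet_bot_iff] at this
  rcases this with rfl | h
  · simp at h0
  · exact h

theorem IsRegularAtomic.exists_parent {n : ℕ} {B : Set Ω} (hB : IsMeasureAtom P (ℱ (n + 1)) B)
    (h0 : 0 < P B) : ∃ B', IsMeasureAtom P (ℱ n) B' ∧ 0 < P B' ∧ P (B \ B') = 0 ∧
      P.real B ≤ P.real B' ∧ P.real B' ≤ R * P.real B := by
  obtain ⟨B', hB', hpos⟩ := hF.exists_atom n B h0
  have hd := (hB.measure_inter_eq_zero_or (ℱ.le _) (ℱ.mono n.le_succ _ hB'.1)).resolve_left hpos.ne'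
  refine ⟨B', hB', hpos.trans_le (measure_mono inter_subset_right), hd, ?_,
    hF.measureReal_le n B B' hB' hB.1 h0 hd⟩
  exact ENNReal.toReal_mono (measure_ne_top P B')
    (by rw [← measure_inter_add_sdiff B (ℱ.le _ _ hB'.1), hd, add_zero]
        exact measure_mono inter_subset_right)

omit [IsProbabilityMeasure P] in
/-- An atom of the next generation agrees with its parent or leaves a sizable part of it. -/
theorem IsRegularAtomic.ae_eq_or_le {n : ℕ} {B B' : Set Ω} (hB : IsMeasureAtom P (ℱ (n + 1)) B)
    (hB' : IsMeasureAtom P (ℱ n) B') (hd : P (B \ B') = 0) :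
    B =ᵐ[P] B' ∨ P.real B' ≤ R * P.real (B' \ B) := by
  by_cases h : P (B' \ B) = 0
  · left
    exact Filter.EventuallyLE.antisymm (ae_le_set.2 hd) (ae_le_set.2 h)
  · right
    exact hF.measureReal_le n _ B' hB'
      (MeasurableSet.diff (ℱ.mono n.le_succ _ hB'.1) hB.1) (pos_iff_ne_zero.2 h) (by simp)

end Regular

/-! ### The Campanato seminorm as a supremum of mean oscillations -/

section Seminorm

variable {Ω : Type*} {m0 : MeasurableSpace Ω} {𝕜 : Type*} [RCLike 𝕜] {P : Measure Ω}
  [IsProbabilityMeasure P] {ℱ : Filtration ℕ m0} {p : ℝ} {θ : ℝ → ℝ} {f : Ω → 𝕜}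

theorem campanato_term_eq (hp : 1 ≤ p) (hf : Integrable f P) {n : ℕ} {B : Set Ω}
    (hB : IsMeasureAtom P (ℱ n) B) (h0 : 0 < P B) :
    ((P B)⁻¹ * ∫⁻ ω in B, ‖f ω - (P[f | ℱ n]) ω‖ₑ ^ p ∂P) ^ (1 / p) =
      meanOscillation (ENNReal.ofReal p) P[|B] f := by
  have hp0 : 0 < p := by linarith
  have hae : ∀ᵐ ω ∂P[|B], f ω - (∫ x, f x ∂P[|B]) = f ω - (P[f | ℱ n]) ω := by
    filter_upwards [hB.condExp_ae_eq (ℱ.le n) h0 hf] with ω hω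
    rw [hω]
  unfold meanOscillation
  rw [eLpNorm_congr_ae hae, eLpNorm_eq_lintegral_rpow_enorm_toReal (by simpa using hp0)
    ENNReal.ofReal_ne_top, ENNReal.toReal_ofReal hp0.le, ProbabilityTheory.cond,
    lintegral_smul_measure, smul_eq_mul]

theorem inv_mul_meanOscillation_le (hp : 1 ≤ p) (hf : Integrable f P) {n : ℕ} {B : Set Ω}
    (hB : IsMeasureAtom P (ℱ n) B) (h0 : 0 < P B) :
    (ENNReal.ofReal (θ (P.real B)))⁻¹ * meanOscillation (ENNReal.ofReal p) P[|B] f ≤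
      campanatoSeminorm P ℱ p θ f := by
  rw [← campanato_term_eq hp hf hB h0]
  exact le_iSup₂_of_le n B (le_iSup₂_of_le hB h0 le_rfl)

theorem meanOscillation_le_seminorm (hp : 1 ≤ p) (hf : Integrable f P) {n : ℕ} {B : Set Ω}
    (hB : IsMeasureAtom P (ℱ n) B) (h0 : 0 < P B) (hθ : 0 < θ (P.real B)) :
    meanOscillation (ENNReal.ofReal p) P[|B] f ≤
      ENNReal.ofReal (θ (P.real B)) * campanatoSeminorm P ℱ p θ f := by
  have h1 := inv_mul_meanOscillation_le (θ := θ) hp hf hB h0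
  rwa [ENNReal.inv_mul_le_iff (by simpa using hθ) ENNReal.ofReal_ne_top] at h1

theorem campanatoSeminorm_le (hp : 1 ≤ p) (hf : Integrable f P)
    (hθ : ∀ r ∈ Ioc (0 : ℝ) 1, 0 < θ r) {K : ℝ≥0∞}
    (h : ∀ n B, IsMeasureAtom P (ℱ n) B → 0 < P B →
      meanOscillation (ENNReal.ofReal p) P[|B] f ≤ ENNReal.ofReal (θ (P.real B)) * K) :
    campanatoSeminorm P ℱ p θ f ≤ K := by
  refine iSup₂_le fun n B => iSup₂_le fun hB h0 => ?_
  rw [campanato_term_eq hp hf hB h0, ENNReal.inv_mul_le_iff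
    (by simpa using hθ _ (measureReal_mem_Ioc h0)) ENNReal.ofReal_ne_top]
  exact h n B hB h0

end Seminorm

/-! ### Growth of means and the upper bound for the operator norm -/

section Upper

variable {Ω : Type*} {m0 : MeasurableSpace Ω} {𝕜 : Type*} [RCLike 𝕜] {P : Measure Ω}
  [IsProbabilityMeasure P] {ℱ : Filtration ℕ m0} {R p : ℝ} {φ : ℝ → ℝ} {f g : Ω → 𝕜}

theorem cond_le_smul_cond {B B' : Set Ω} (hR : 0 < R) (h0 : 0 < P B) (hd : P (B \ B') = 0)
    (hle : P.real B' ≤ R * P.real B) : P[|B] ≤ ENNReal.ofReal R • P[|B'] := by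
  have h : (P B)⁻¹ ≤ ENNReal.ofReal R * (P B')⁻¹ := by
    have h1 : P B' ≤ ENNReal.ofReal R * P B := by
      rw [← ofReal_measureReal (μ := P) (s := B'), ← ofReal_measureReal (μ := P) (s := B),
        ← ENNReal.ofReal_mul hR.le]
      exact ENNReal.ofReal_le_ofReal hle
    rw [← div_eq_mul_inv, ENNReal.le_div_iff_mul_le (Or.inr ?_) (Or.inl (measure_ne_top _ _)),
      ENNReal.inv_mul_le_iff h0.ne' (measure_ne_top _ _), mul_comm]
    · exact h1
    · simpa using hR
  unfold ProbabilityTheory.cond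
  rw [smul_smul, Measure.le_iff']
  exact fun s => mul_le_mul' h (Measure.restrict_mono_ae (ae_le_set.2 hd) s)

theorem enorm_integral_cond_sub_le {q : ℝ≥0∞} (hq : 1 ≤ q) (hf : Integrable f P) {B B' : Set Ω}
    (hR : 0 < R) (h0 : 0 < P B) (h0' : 0 < P B') (hd : P (B \ B') = 0)
    (hle : P.real B' ≤ R * P.real B) :
    ‖(∫ x, f x ∂P[|B]) - ∫ x, f x ∂P[|B']‖ₑ ≤ ENNReal.ofReal R * meanOscillation q P[|B'] f := by
  have : IsProbabilityMeasure P[|B] := cond_isProbabilityMeasure h0.ne'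
  have : IsProbabilityMeasure P[|B'] := cond_isProbabilityMeasure h0'.ne'
  refine (enorm_integral_sub_const_le (integrable_cond hf h0) _).trans ?_
  refine (eLpNorm_mono_measure _ (cond_le_smul_cond hR h0 hd hle)).trans ?_
  rw [eLpNorm_smul_measure_of_ne_top ENNReal.one_ne_top]
  simp only [one_div, inv_one, ENNReal.toReal_one, ENNReal.rpow_one, smul_eq_mul]
  gcongr
  exact eLpNorm_le_eLpNorm_of_exponent_le hq
    ((integrable_cond hf h0').aestronglyMeasurable.sub aestronglyMeasurable_const)

/-- Passing from a parent B' to a child changes the mean by at most R φ(P(B')) ‖f‖. If the child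
agrees with B' up to a null set, nothing changes; otherwise regularity makes P(B' \ B) sizable, and
the cost is absorbed by the increment of φ_*. -/
theorem exists_enorm_integral_cond_le (hF : IsRegularAtomic P ℱ R) (hp : 1 ≤ p)
    (hpos : ∀ r ∈ Ioc (0 : ℝ) 1, 0 < φ r)
    (hmeas : AEMeasurable φ (volume.restrict (Ioc (0 : ℝ) 1))) (hd : Doubling φ) :
    ∃ K : ℝ, 1 ≤ K ∧ ∀ f : Ω → 𝕜, Integrable f P → ∀ n B, IsMeasureAtom P (ℱ n) B → 0 < P B →
      ‖∫ x, f x ∂P[|B]‖ₑ ≤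
        ENNReal.ofReal (K * lowerStar φ (P.real B)) * campanatoNorm P ℱ p φ f := by
  have hR := hF.two_le
  have hR0 : 0 ≤ R := by linarith
  obtain ⟨K, hK, hstep⟩ := exists_le_lowerStar_sub hpos hmeas hd (R := R) (by linarith)
  have hRK : 1 ≤ R * K := one_le_mul_of_one_le_of_one_le (by linarith) hK
  -- The factor equals 1 at the root, where φ_*(1) = 1, and grows by R K times the increment of φ_*
  -- at each step.
  have main : ∀ f : Ω → 𝕜, Integrable f P → ∀ n B, IsMeasureAtom P (ℱ n) B → 0 < P B →
      ‖∫ x, f x ∂P[|B]‖ₑ ≤ ENNReal.ofReal (1 + R * K * (lowerStar φ (P.real B) - 1)) *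
        campanatoNorm P ℱ p φ f := by
    intro f hf n
    induction n with
    | zero =>
      intro B hB h0
      rw [hF.eq_univ hB h0, cond_univ]
      simp [lowerStar_one, campanatoNorm]
    | succ n ih =>
      intro B hB h0
      obtain ⟨B', hB', h0', hdiff, hle, hle'⟩ := hF.exists_parent hB h0
      rcases hF.ae_eq_or_le hB hB' hdiff with h | h
      · rw [cond_congr h, measureReal_congr h]
        exact ih B' hB' h0'
      · have hi : P.real B' = P.real B + P.real (B' \ B) := by
          rw [← measureReal_inter_add_sdiff (s := B') (ℱ.le _ _ hB.1)]
          congr 1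
          rw [inter_comm, measureReal_def, measureReal_def,
            ← measure_inter_add_sdiff B (ℱ.le _ _ hB'.1), hdiff, add_zero]
        have hr := hstep _ (measureReal_mem_Ioc h0) _ (measureReal_mem_Ioc h0') hle'
          (by rwa [hi, add_sub_cancel_left, ← hi])
        have hone := one_le_lowerStar hpos hmeas hd (measureReal_mem_Ioc h0')
        have hφ := hpos _ (measureReal_mem_Ioc h0')
        calc ‖∫ x, f x ∂P[|B]‖ₑ
            ≤ ‖∫ x, f x ∂P[|B']‖ₑ + ‖(∫ x, f x ∂P[|B]) - ∫ x, f x ∂P[|B']‖ₑ := by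
              refine le_trans (le_of_eq ?_) (enorm_add_le _ _)
              simp
          _ ≤ ENNReal.ofReal (1 + R * K * (lowerStar φ (P.real B') - 1)) *
                campanatoNorm P ℱ p φ f + ENNReal.ofReal R *
                (ENNReal.ofReal (φ (P.real B')) * campanatoNorm P ℱ p φ f) := by
              gcongr
              · exact ih B' hB' h0'
              · refine (enorm_integral_cond_sub_le (q := ENNReal.ofReal p) (by simpa using hp) hf
                  (by linarith) h0 h0' hdiff hle').trans ?_
                gcongr
                refine (meanOscillation_le_seminorm hp hf hB' h0' hφ).trans ?_
                gcongr
                exact le_self_add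
          _ = ENNReal.ofReal (1 + R * K * (lowerStar φ (P.real B') - 1) + R * φ (P.real B')) *
                campanatoNorm P ℱ p φ f := by
              have : 0 ≤ R * K * (lowerStar φ (P.real B') - 1) :=
                mul_nonneg (by linarith) (by linarith)
              rw [← mul_assoc, ← add_mul, ← ENNReal.ofReal_mul hR0,
                ENNReal.ofReal_add (q := R * φ (P.real B')) (by linarith) (by positivity)]
          _ ≤ _ := by
              refine mul_le_mul_left (ENNReal.ofReal_le_ofReal ?_) _
              have := mul_le_mul_of_nonneg_left hr hR0
              linarith
  refine ⟨R * K, hRK, fun f hf n B hB h0 => (main f hf n B hB h0).trans ?_⟩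
  gcongr
  linarith

omit [IsProbabilityMeasure P] in
theorem eLpNorm_top_cond_le {B : Set Ω} : eLpNorm g ∞ P[|B] ≤ eLpNorm g ∞ P :=
  eLpNormEssSup_mono_measure g cond_absolutelyContinuous

theorem eLpNorm_mul_le_top {ν : Measure Ω} {q : ℝ≥0∞} (hf : AEStronglyMeasurable f ν) :
    eLpNorm (fun ω => f ω * g ω) q ν ≤ eLpNorm g ∞ ν * eLpNorm f q ν := by
  have := eLpNorm_smul_le_eLpNorm_top_mul_eLpNorm q hf g
  refine le_trans (le_of_eq ?_) this
  congr 1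
  ext ω
  simp [mul_comm]

/-- The product is compared with the constant given by the product of the two means, which costs the
factor 2. -/
theorem meanOscillation_mul_le {ν : Measure Ω} [IsProbabilityMeasure ν] {q : ℝ≥0∞} (hq : 1 ≤ q)
    (hf : Integrable f ν) (hg : Integrable g ν) (hfg : Integrable (f * g) ν) :
    meanOscillation q ν (f * g) ≤
      2 * (eLpNorm g ∞ ν * meanOscillation q ν f + ‖∫ x, f x ∂ν‖ₑ * meanOscillation q ν g) := by
  refine (meanOscillation_le_two_mul hq hfg ((∫ x, f x ∂ν) * ∫ x, g x ∂ν)).trans ?_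
  gcongr
  have hf' : AEStronglyMeasurable (fun ω => f ω - ∫ x, f x ∂ν) ν :=
    hf.aestronglyMeasurable.sub aestronglyMeasurable_const
  have hg' : AEStronglyMeasurable (fun ω => g ω - ∫ x, g x ∂ν) ν :=
    hg.aestronglyMeasurable.sub aestronglyMeasurable_const
  have e : (fun ω => (f * g) ω - (∫ x, f x ∂ν) * ∫ x, g x ∂ν) =
      (fun ω => (f ω - ∫ x, f x ∂ν) * g ω) +
        (∫ x, f x ∂ν) • fun ω => g ω - ∫ x, g x ∂ν := by
    ext ω
    simp only [Pi.mul_apply, Pi.add_apply, Pi.smul_apply, smul_eq_mul]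
    ring
  rw [e]
  refine (eLpNorm_add_le (hf'.mul hg.aestronglyMeasurable) (hg'.const_smul _) hq).trans ?_
  rw [eLpNorm_const_smul]
  gcongr
  · exact eLpNorm_mul_le_top hf'
  · rfl

/-- Since Ω is an atom of the trivial σ-algebra, the seminorm controls the oscillation on all of Ω.
The embedding into L^1 makes the norm definite and supports the closed graph argument. -/
theorem eLpNorm_one_le_campanatoNorm (hF : IsRegularAtomic P ℱ R) (hp : 1 ≤ p) (hφ1 : 0 < φ 1)
    (hf : Integrable f P) :
    eLpNorm f 1 P ≤ ENNReal.ofReal (φ 1 + 1) * campanatoNorm P ℱ p φ f := by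
  have hq : 1 ≤ ENNReal.ofReal p := by simpa using hp
  have h := meanOscillation_le_seminorm (θ := φ) hp hf hF.isMeasureAtom_univ (by simp)
    (by simpa using hφ1)
  rw [cond_univ, probReal_univ] at h
  calc eLpNorm f 1 P ≤ meanOscillation (ENNReal.ofReal p) P f + ‖∫ x, f x ∂P‖ₑ :=
        (eLpNorm_le_eLpNorm_of_exponent_le hq hf.aestronglyMeasurable).trans
          (eLpNorm_le_meanOscillation_add hq hf.aestronglyMeasurable)
    _ ≤ ENNReal.ofReal (φ 1) * campanatoNorm P ℱ p φ f + campanatoNorm P ℱ p φ f := by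
        gcongr
        · refine h.trans ?_
          gcongr
          exact le_self_add
        · exact le_add_self
    _ = _ := by
        rw [ENNReal.ofReal_add hφ1.le zero_le_one, ENNReal.ofReal_one]
        ring

theorem exists_campanatoNorm_mul_le (hF : IsRegularAtomic P ℱ R) (hp : 1 ≤ p)
    (hpos : ∀ r ∈ Ioc (0 : ℝ) 1, 0 < φ r)
    (hmeas : AEMeasurable φ (volume.restrict (Ioc (0 : ℝ) 1))) (hd : Doubling φ) :
    ∃ C : ℝ, 0 < C ∧ ∀ f g : Ω → 𝕜, Integrable f P → Integrable g P → Integrable (f * g) P →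
      campanatoNorm P ℱ p φ (f * g) ≤ ENNReal.ofReal C *
        (campanatoSeminorm P ℱ p (fun r => φ r / lowerStar φ r) g + eLpNorm g ∞ P) *
        campanatoNorm P ℱ p φ f := by
  obtain ⟨K, hK, havg⟩ := exists_enorm_integral_cond_le (𝕜 := 𝕜) hF hp hpos hmeas hd
  have hK0 : 0 ≤ K := by linarith
  have hφ1 := hpos 1 (by simp)
  have hq : 1 ≤ ENNReal.ofReal p := by simpa using hp
  -- The summand 2 K comes from the seminorm, and φ(1) + 1 from |E(fg)| through the L^1 embedding.
  refine ⟨2 * K + (φ 1 + 1), by linarith, fun f g hf hg hfg => ?_⟩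
  set S := campanatoSeminorm P ℱ p (fun r => φ r / lowerStar φ r) g
  set M := eLpNorm g ∞ P
  set N := campanatoNorm P ℱ p φ f with hN
  have hSN : campanatoSeminorm P ℱ p φ f ≤ N := le_self_add
  have h1 : campanatoSeminorm P ℱ p φ (f * g) ≤ ENNReal.ofReal (2 * K) * (S + M) * N := by
    refine campanatoSeminorm_le hp hfg hpos fun n B hB h0 => ?_
    have : IsProbabilityMeasure P[|B] := cond_isProbabilityMeasure h0.ne'
    have hr := measureReal_mem_Ioc h0
    have hls : 0 < lowerStar φ (P.real B) := by linarith [one_le_lowerStar hpos hmeas hd hr]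
    have hφ := hpos _ hr
    have hθ : 0 < φ (P.real B) / lowerStar φ (P.real B) := by positivity
    refine (meanOscillation_mul_le hq (integrable_cond hf h0) (integrable_cond hg h0)
      (integrable_cond hfg h0)).trans ?_
    calc 2 * (eLpNorm g ∞ P[|B] * meanOscillation (ENNReal.ofReal p) P[|B] f +
            ‖∫ x, f x ∂P[|B]‖ₑ * meanOscillation (ENNReal.ofReal p) P[|B] g)
        ≤ 2 * (M * (ENNReal.ofReal (φ (P.real B)) * N) +
            (ENNReal.ofReal (K * lowerStar φ (P.real B)) * N) *
              (ENNReal.ofReal (φ (P.real B) / lowerStar φ (P.real B)) * S)) := by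
          gcongr
          · exact eLpNorm_top_cond_le
          · exact (meanOscillation_le_seminorm hp hf hB h0 hφ).trans (by gcongr)
          · exact havg f hf n B hB h0
          · exact meanOscillation_le_seminorm (θ := fun r => φ r / lowerStar φ r) hp hg hB h0 hθ
      _ = 2 * (M * (ENNReal.ofReal (φ (P.real B)) * N) +
            (ENNReal.ofReal (K * lowerStar φ (P.real B)) *
              ENNReal.ofReal (φ (P.real B) / lowerStar φ (P.real B))) * (S * N)) := by ring
      _ = ENNReal.ofReal (φ (P.real B)) * (2 * (M + ENNReal.ofReal K * S) * N) := by
          rw [← ENNReal.ofReal_mul (by positivity), mul_assoc, mul_div_cancel₀ _ hls.ne',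
            ENNReal.ofReal_mul hK0]
          ring
      _ ≤ ENNReal.ofReal (φ (P.real B)) * (ENNReal.ofReal (2 * K) * (S + M) * N) := by
          rw [ENNReal.ofReal_mul two_pos.le, ENNReal.ofReal_ofNat]
          gcongr _ * (?_ * N)
          rw [mul_assoc]
          gcongr
          rw [mul_add, add_comm]
          gcongr
          exact le_mul_of_one_le_left' (by simpa using hK)
  have h2 : ‖∫ ω, (f * g) ω ∂P‖ₑ ≤ ENNReal.ofReal (φ 1 + 1) * (S + M) * N := by
    calc ‖∫ ω, (f * g) ω ∂P‖ₑ ≤ eLpNorm (fun ω => f ω * g ω) 1 P := by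
          rw [eLpNorm_one_eq_lintegral_enorm]
          exact enorm_integral_le_lintegral_enorm _
      _ ≤ M * eLpNorm f 1 P := eLpNorm_mul_le_top hf.aestronglyMeasurable
      _ ≤ M * (ENNReal.ofReal (φ 1 + 1) * N) := by
          gcongr
          exact eLpNorm_one_le_campanatoNorm hF hp hφ1 hf
      _ = ENNReal.ofReal (φ 1 + 1) * M * N := by ring
      _ ≤ _ := by
          gcongr
          exact le_add_self
  calc campanatoNorm P ℱ p φ (f * g) ≤ _ := add_le_add h1 h2
    _ = _ := by
      rw [ENNReal.ofReal_add (p := 2 * K) (by positivity) (by linarith)]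
      ring

end Upper

/-! ### Test functions: indicators of atoms and sums along chains -/

section TestFunctions

variable {Ω : Type*} {m0 : MeasurableSpace Ω} {𝕜 : Type*} [RCLike 𝕜] {P : Measure Ω}
  [IsProbabilityMeasure P] {ℱ : Filtration ℕ m0} {R p : ℝ} {φ : ℝ → ℝ}

theorem measureReal_le_of_measure_diff_eq_zero {A B : Set Ω} (h : P (A \ B) = 0) :
    P.real A ≤ P.real B :=
  ENNReal.toReal_mono (measure_ne_top P B) (measure_mono_ae (ae_le_set.2 h))

theorem IsMeasureAtom.meanOscillation_eq_zero {m : MeasurableSpace Ω} {B : Set Ω}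
    (hB : IsMeasureAtom P m B) (hm : m ≤ m0) (h0 : 0 < P B) {q : ℝ≥0∞} {f : Ω → 𝕜}
    (hf : StronglyMeasurable[m] f) : meanOscillation q P[|B] f = 0 := by
  obtain ⟨c, hc⟩ := hB.exists_ae_eq_const hm hf
  have : IsProbabilityMeasure P[|B] := cond_isProbabilityMeasure h0.ne'
  rw [meanOscillation_congr (g := fun _ => c) hc]
  simp [meanOscillation]

theorem eLpNorm_indicator_cond_le (hp : 1 ≤ p) {A B : Set Ω} (hA : MeasurableSet A)
    (hB : MeasurableSet B) (h0 : 0 < P B) :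
    eLpNorm (A.indicator fun _ => (1 : 𝕜)) (ENNReal.ofReal p) P[|B] ≤
      ENNReal.ofReal ((P.real A / P.real B) ^ (1 / p)) := by
  have hp0 : 0 < p := by linarith
  have hb := (measureReal_mem_Ioc h0).1
  rw [eLpNorm_indicator_const hA (by simpa using hp0) ENNReal.ofReal_ne_top,
    ENNReal.toReal_ofReal hp0.le, enorm_one, one_mul,
    ← ENNReal.ofReal_rpow_of_nonneg (by positivity) (by positivity)]
  refine ENNReal.rpow_le_rpow ?_ (by positivity)
  rw [cond_apply hB, ENNReal.ofReal_div_of_pos hb, ofReal_measureReal, ofReal_measureReal,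
    ENNReal.div_eq_inv_mul]
  gcongr
  exact inter_subset_right

theorem campanatoNorm_one (hp : 1 ≤ p) (hpos : ∀ r ∈ Ioc (0 : ℝ) 1, 0 < φ r) :
    campanatoNorm P ℱ p φ (fun _ => (1 : 𝕜)) ≤ 1 := by
  have : campanatoSeminorm P ℱ p φ (fun _ => (1 : 𝕜)) ≤ 0 :=
    campanatoSeminorm_le hp (integrable_const _) hpos fun n B hB h0 => by
      rw [hB.meanOscillation_eq_zero (ℱ.le n) h0 stronglyMeasurable_const]
      simp
  unfold campanatoNorm
  rw [nonpos_iff_eq_zero.1 this]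
  simp

/-- Only atoms B' of earlier generations that contain B up to a null set see an oscillation. It is
at most 2 (P(B)/P(B'))^(1/p), and almost monotonicity of r^(1/p) φ(r) turns this into 2 K
φ(P(B'))/φ(P(B)). -/
theorem exists_campanatoNorm_indicator_le (hp : 1 ≤ p)
    (hpos : ∀ r ∈ Ioc (0 : ℝ) 1, 0 < φ r) (hd : Doubling φ) (hint : IntegralCondition p φ) :
    ∃ C : ℝ, 0 < C ∧ ∀ n B, IsMeasureAtom P (ℱ n) B → 0 < P B →
      campanatoNorm P ℱ p φ (B.indicator fun _ => (1 : 𝕜)) ≤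
        ENNReal.ofReal (C / φ (P.real B)) := by
  obtain ⟨K, -, hK, -, -, hmono, -⟩ := exists_geometric_decay hp hpos hd hint
  have hp0 : 0 < p := by linarith
  have hφ1 := hpos 1 (by simp)
  have hq : 1 ≤ ENNReal.ofReal p := by simpa using hp
  have hK0 : 0 < K := by linarith
  refine ⟨2 * K + K * φ 1, by positivity, fun n B hB h0 => ?_⟩
  have hBm := ℱ.le _ _ hB.1
  have hb := measureReal_mem_Ioc h0
  have hφ := hpos _ hb
  have hf : Integrable (B.indicator fun _ => (1 : 𝕜)) P := (integrable_const 1).indicator hBm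
  have h1 : campanatoSeminorm P ℱ p φ (B.indicator fun _ => (1 : 𝕜)) ≤
      ENNReal.ofReal (2 * K / φ (P.real B)) := by
    refine campanatoSeminorm_le hp hf hpos fun m B' hB' h0' => ?_
    have : IsProbabilityMeasure P[|B'] := cond_isProbabilityMeasure h0'.ne'
    have hB'm := ℱ.le _ _ hB'.1
    rcases le_total n m with hnm | hmn
    · rw [hB'.meanOscillation_eq_zero (ℱ.le m) h0'
        (stronglyMeasurable_const.indicator (ℱ.mono hnm _ hB.1))]
      simp
    rcases hB.measure_inter_eq_zero_or (ℱ.le n) (ℱ.mono hmn _ hB'.1) with h | h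
    · have : B.indicator (fun _ => (1 : 𝕜)) =ᵐ[P[|B']] fun _ => 0 := by
        refine (ae_cond_iff_ae hB'm).2 ?_
        filter_upwards [measure_eq_zero_iff_ae_notMem.1 h] with ω hω hω'
        exact indicator_of_notMem (fun hωB => hω ⟨hωB, hω'⟩) _
      rw [meanOscillation_congr this]
      simp [meanOscillation]
    · have hle := measureReal_le_of_measure_diff_eq_zero h
      have hb' := measureReal_mem_Ioc h0'
      have hφ' := hpos _ hb'
      refine (meanOscillation_le_two_mul hq (integrable_cond hf h0') 0).trans ?_
      simp only [sub_zero]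
      calc 2 * eLpNorm (B.indicator fun _ => (1 : 𝕜)) (ENNReal.ofReal p) P[|B']
          ≤ 2 * ENNReal.ofReal ((P.real B / P.real B') ^ (1 / p)) := by
            gcongr
            exact eLpNorm_indicator_cond_le hp hBm hB'm h0'
        _ = ENNReal.ofReal (2 * (P.real B / P.real B') ^ (1 / p)) := by
            rw [ENNReal.ofReal_mul two_pos.le, ENNReal.ofReal_ofNat]
        _ ≤ ENNReal.ofReal (φ (P.real B') * (2 * K / φ (P.real B))) := by
            refine ENNReal.ofReal_le_ofReal ?_
            have h2 := hmono _ hb _ hb' hle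
            rw [Real.div_rpow hb.1.le hb'.1.le, mul_div_assoc', mul_div_assoc',
              div_le_div_iff₀ (Real.rpow_pos_of_pos hb'.1 _) hφ]
            linarith
        _ = _ := ENNReal.ofReal_mul hφ'.le
  have h2 : ‖∫ ω, B.indicator (fun _ => (1 : 𝕜)) ω ∂P‖ₑ ≤
      ENNReal.ofReal (K * φ 1 / φ (P.real B)) := by
    rw [integral_indicator_const _ hBm, ← ofReal_norm, norm_smul, norm_one, mul_one,
      Real.norm_of_nonneg measureReal_nonneg]
    refine ENNReal.ofReal_le_ofReal ?_
    rw [le_div_iff₀ hφ]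
    have h3 := hmono _ hb 1 (by simp) hb.2
    rw [Real.one_rpow, one_mul] at h3
    refine le_trans ?_ h3
    gcongr
    calc P.real B = P.real B ^ (1 : ℝ) := (Real.rpow_one _).symm
      _ ≤ _ := Real.rpow_le_rpow_of_exponent_ge hb.1 hb.2 ((div_le_one hp0).2 hp)
  unfold campanatoNorm
  rw [add_div, ENNReal.ofReal_add (by positivity) (by positivity)]
  exact add_le_add h1 h2

/-- `D 0, …, D n` is a decreasing sequence (up to null sets) of atoms of positive measure. -/
structure IsAtomChain (P : Measure Ω) (ℱ : Filtration ℕ m0) (n : ℕ) (D : ℕ → Set Ω) : Prop where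
  atom : ∀ k ≤ n, IsMeasureAtom P (ℱ k) (D k)
  pos : ∀ k ≤ n, 0 < P (D k)
  step : ∀ k < n, P (D (k + 1) \ D k) = 0

theorem IsRegularAtomic.exists_chain (hF : IsRegularAtomic P ℱ R) (n : ℕ) :
    ∀ B, IsMeasureAtom P (ℱ n) B → 0 < P B → ∃ D, IsAtomChain P ℱ n D ∧ D n = B := by
  induction n with
  | zero =>
    intro B hB h0
    refine ⟨fun _ => B, ⟨fun k hk => ?_, fun k hk => h0, fun k hk => absurd hk (by omega)⟩, rfl⟩
    obtain rfl : k = 0 := by omega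
    exact hB
  | succ n ih =>
    intro B hB h0
    obtain ⟨B', hB', h0', hd, -⟩ := hF.exists_parent hB h0
    obtain ⟨D, hD, hDn⟩ := ih B' hB' h0'
    refine ⟨Function.update D (n + 1) B, ⟨fun k hk => ?_, fun k hk => ?_, fun k hk => ?_⟩,
      Function.update_self _ _ _⟩
    · rcases eq_or_ne k (n + 1) with rfl | hne
      · rwa [Function.update_self]
      · rw [Function.update_of_ne hne]
        exact hD.atom k (by omega)
    · rcases eq_or_ne k (n + 1) with rfl | hne
      · rwa [Function.update_self]
      · rw [Function.update_of_ne hne]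
        exact hD.pos k (by omega)
    · rw [Function.update_of_ne (by omega : k ≠ n + 1)]
      rcases eq_or_ne k n with rfl | hne
      · rwa [Function.update_self, hDn]
      · rw [Function.update_of_ne (by omega : k + 1 ≠ n + 1)]
        exact hD.step k (by omega)

omit [IsProbabilityMeasure P] in
theorem IsAtomChain.diff_eq_zero {n : ℕ} {D : ℕ → Set Ω} (hD : IsAtomChain P ℱ n D) {j k : ℕ}
    (hjk : j ≤ k) (hkn : k ≤ n) : P (D k \ D j) = 0 := by
  induction k, hjk using Nat.le_induction with
  | base => simp
  | succ k hjk ih =>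
    refine measure_mono_null (fun ω hω => ?_)
      (measure_union_null (hD.step k (by omega)) (ih (by omega)))
    by_cases h : ω ∈ D k
    · exact Or.inr ⟨h, hω.2⟩
    · exact Or.inl ⟨hω.1, h⟩

/-- The sum is a lower sum for the integral: b (k + 1)^(1/p) ≤ t^(1/p) for t between b (k + 1) and b
k. -/
theorem sum_lowerStar_sub_mul_rpow_le (hp : 1 ≤ p) (hpos : ∀ r ∈ Ioc (0 : ℝ) 1, 0 < φ r)
    (hmeas : AEMeasurable φ (volume.restrict (Ioc (0 : ℝ) 1))) (hd : Doubling φ)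
    {b : ℕ → ℝ} {m n : ℕ} (hmn : m ≤ n) (hb : ∀ k ≤ n, b k ∈ Ioc (0 : ℝ) 1)
    (hanti : ∀ k < n, b (k + 1) ≤ b k) :
    b n ≤ b m ∧ ∑ k ∈ Finset.Ico m n,
      (lowerStar φ (b (k + 1)) - lowerStar φ (b k)) * b (k + 1) ^ (1 / p) ≤
        ∫ t in b n..b m, φ t * t ^ (1 / p - 1) := by
  induction n, hmn using Nat.le_induction with
  | base => simp
  | succ n hmn ih =>
    obtain ⟨ih1, ih2⟩ := ih (fun k hk => hb k (by omega)) (fun k hk => hanti k (by omega))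
    have h1 := hb (n + 1) le_rfl
    have h2 := hb n (by omega)
    have h12 := hanti n (by omega)
    refine ⟨h12.trans ih1, ?_⟩
    rw [Finset.sum_Ico_succ_top hmn, lowerStar_sub hpos hmeas hd h1.1 h12 h2.2,
      ← intervalIntegral.integral_add_adjacent_intervals
        (intervalIntegrable_mul_rpow hpos hmeas hd _ h1.1 h12 h2.2)
        (intervalIntegrable_mul_rpow hpos hmeas hd _ h2.1 ih1 (hb m (by omega)).2), add_comm,
      ← intervalIntegral.integral_mul_const]
    refine add_le_add ?_ ih2
    refine intervalIntegral.integral_mono_on h12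
      ((intervalIntegrable_div hpos hmeas hd h1.1 h12 h2.2).mul_const _)
      (intervalIntegrable_mul_rpow hpos hmeas hd _ h1.1 h12 h2.2) fun t ht => ?_
    have ht0 : 0 < t := h1.1.trans_le ht.1
    rw [Real.rpow_sub_one ht0.ne', div_mul_eq_mul_div, mul_div_assoc]
    have := (hpos t ⟨ht0, ht.2.trans h2.2⟩).le
    have h3 := h1.1.le
    gcongr
    exact ht.1

/-- There are functions of bounded Campanato norm which equal `φ_*(P(B))` on the atom `B`. -/
theorem exists_test_function (hF : IsRegularAtomic P ℱ R) (hp : 1 ≤ p)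
    (hpos : ∀ r ∈ Ioc (0 : ℝ) 1, 0 < φ r)
    (hmeas : AEMeasurable φ (volume.restrict (Ioc (0 : ℝ) 1)))
    (hd : Doubling φ) (hint : IntegralCondition p φ) :
    ∃ C : ℝ, 0 < C ∧ ∀ n B, IsMeasureAtom P (ℱ n) B → 0 < P B →
      ∃ f : Ω → 𝕜, Integrable f P ∧ campanatoNorm P ℱ p φ f ≤ ENNReal.ofReal C ∧
        ∀ᵐ ω ∂P[|B], f ω = (lowerStar φ (P.real B) : 𝕜) := by
  obtain ⟨K, hK, hardy⟩ := exists_hardy hp hpos hmeas hd hint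
  have hp0 : 0 < p := by linarith
  have hφ1 := hpos 1 (by simp)
  have hq : 1 ≤ ENNReal.ofReal p := by simpa using hp
  have hK0 : 0 < K := by linarith
  refine ⟨2 * K + (1 + K * φ 1), by positivity, fun n B hB h0 => ?_⟩
  obtain ⟨D, hD, rfl⟩ := hF.exists_chain n B hB h0
  -- The test function is 1 + ∑ a k 1_{D (k + 1)} over k < n. On D n all indicators are 1 and the
  -- sum telescopes from φ_*(1) = 1 to φ_*(P(D n)).
  set a : ℕ → ℝ := fun k => lowerStar φ (P.real (D (k + 1))) - lowerStar φ (P.real (D k)) with ha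
  set u : ℕ → Ω → 𝕜 := fun k => (a k : 𝕜) • (D (k + 1)).indicator fun _ => (1 : 𝕜) with hu
  have hDm : ∀ k ≤ n, MeasurableSet (D k) := fun k hk => ℱ.le _ _ (hD.atom k hk).1
  have hb : ∀ k ≤ n, P.real (D k) ∈ Ioc (0 : ℝ) 1 := fun k hk => measureReal_mem_Ioc (hD.pos k hk)
  have hanti : ∀ k < n, P.real (D (k + 1)) ≤ P.real (D k) := fun k hk =>
    measureReal_le_of_measure_diff_eq_zero (hD.step k hk)
  have ha0 : ∀ k < n, 0 ≤ a k := fun k hk =>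
    sub_nonneg.2 (lowerStar_anti hpos hmeas hd (hb _ hk).1 (hanti k hk) (hb k hk.le).2)
  have hui : ∀ k < n, Integrable (u k) P := fun k hk =>
    ((integrable_const (1 : 𝕜)).indicator (hDm _ hk)).smul (a k : 𝕜)
  have hum : ∀ k m, k < m → m ≤ n → StronglyMeasurable[ℱ m] (u k) := fun k m hkm hmn =>
    (stronglyMeasurable_const.indicator (ℱ.mono hkm _ (hD.atom _ (by omega)).1)).const_smul _
  -- An atom A of generation m is either disjoint from D m up to a null set, and then the tail
  -- vanishes on it, or agrees with D m almost everywhere, and then the Hardy bound applies.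
  have tail : ∀ m ≤ n, ∀ A, IsMeasureAtom P (ℱ m) A → 0 < P A →
      eLpNorm (∑ k ∈ Finset.Ico m n, u k) (ENNReal.ofReal p) P[|A] ≤
        ENNReal.ofReal (K * φ (P.real A)) := by
    intro m hmn A hA hA0
    have hAm := ℱ.le _ _ hA.1
    rcases hA.measure_inter_eq_zero_or (ℱ.le m) (hD.atom m hmn).1 with h | h
    · have hz : (∑ k ∈ Finset.Ico m n, u k) =ᵐ[P[|A]] 0 := by
        have h1 : ∀ k ∈ Finset.Ico m n, u k =ᵐ[P[|A]] 0 := by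
          intro k hk
          rw [Finset.mem_Ico] at hk
          refine (ae_cond_iff_ae hAm).2 ?_
          filter_upwards [measure_eq_zero_iff_ae_notMem.1 h, measure_eq_zero_iff_ae_notMem.1
            (hD.diff_eq_zero (j := m) (k := k + 1) (by omega) (by omega))] with ω h1 h2 hω
          have : ω ∉ D (k + 1) := fun h3 => h2 ⟨h3, fun h4 => h1 ⟨hω, h4⟩⟩
          simp [hu, this]
        have h2 := (Filter.eventually_all_finset _).2 h1
        filter_upwards [h2] with ω hω
        simp only [Finset.sum_apply, Pi.zero_apply]
        exact Finset.sum_eq_zero fun k hk => hω k hk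
      rw [eLpNorm_congr_ae hz, eLpNorm_zero]
      exact zero_le
    · have hDA := ((hD.atom m hmn).measure_inter_eq_zero_or (ℱ.le m) hA.1).resolve_left
        (fun h' => hA0.ne' (by
          rw [← measure_inter_add_sdiff A (hDm m hmn), h, add_zero, inter_comm]
          exact h'))
      have hAD : P.real A = P.real (D m) :=
        le_antisymm (measureReal_le_of_measure_diff_eq_zero h)
          (measureReal_le_of_measure_diff_eq_zero hDA)
      have hbm := hb m hmn
      obtain ⟨hnm, hsum⟩ := sum_lowerStar_sub_mul_rpow_le hp hpos hmeas hd hmn hb hanti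
      calc eLpNorm (∑ k ∈ Finset.Ico m n, u k) (ENNReal.ofReal p) P[|A]
          ≤ ∑ k ∈ Finset.Ico m n, eLpNorm (u k) (ENNReal.ofReal p) P[|A] := by
            refine eLpNorm_sum_le (fun k hk => ?_) hq
            rw [Finset.mem_Ico] at hk
            exact (integrable_cond (hui k hk.2) hA0).aestronglyMeasurable
        _ ≤ ∑ k ∈ Finset.Ico m n,
              ENNReal.ofReal (a k * P.real (D (k + 1)) ^ (1 / p) / P.real A ^ (1 / p)) := by
            refine Finset.sum_le_sum fun k hk => ?_
            rw [Finset.mem_Ico] at hk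
            rw [hu, eLpNorm_const_smul, mul_div_assoc,
              ← Real.div_rpow (hb _ hk.2).1.le measureReal_nonneg, ENNReal.ofReal_mul (ha0 k hk.2),
              ← ofReal_norm, RCLike.norm_ofReal, abs_of_nonneg (ha0 k hk.2)]
            gcongr
            exact eLpNorm_indicator_cond_le hp (hDm _ hk.2) hAm hA0
        _ = ENNReal.ofReal ((∑ k ∈ Finset.Ico m n, a k * P.real (D (k + 1)) ^ (1 / p)) /
              P.real A ^ (1 / p)) := by
            rw [Finset.sum_div, ENNReal.ofReal_sum_of_nonneg]
            intro k hk
            rw [Finset.mem_Ico] at hk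
            have := ha0 k hk.2
            positivity
        _ ≤ _ := by
            refine ENNReal.ofReal_le_ofReal ?_
            rw [hAD, div_le_iff₀ (Real.rpow_pos_of_pos hbm.1 _)]
            refine (hsum.trans (hardy _ (hb n le_rfl) _ hbm hnm)).trans_eq ?_
            ring
  have hsumi : Integrable (∑ k ∈ Finset.Ico 0 n, u k) P :=
    integrable_finsetSum' _ fun k hk => hui k (Finset.mem_Ico.1 hk).2
  refine ⟨(fun _ => 1) + ∑ k ∈ Finset.Ico 0 n, u k, (integrable_const _).add hsumi, ?_, ?_⟩
  · have h1 : campanatoSeminorm P ℱ p φ ((fun _ => 1) + ∑ k ∈ Finset.Ico 0 n, u k) ≤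
        ENNReal.ofReal (2 * K) := by
      refine campanatoSeminorm_le hp ((integrable_const _).add hsumi) hpos fun m A hA hA0 => ?_
      have : IsProbabilityMeasure P[|A] := cond_isProbabilityMeasure hA0.ne'
      have hAm := ℱ.le _ _ hA.1
      have hφA := hpos _ (measureReal_mem_Ioc hA0)
      have hsm : ∀ j, j ≤ n → j ≤ m →
          StronglyMeasurable[ℱ m] ((fun _ => (1 : 𝕜)) + ∑ k ∈ Finset.Ico 0 j, u k) :=
        fun j hjn hjm => stronglyMeasurable_const.add
          (Finset.stronglyMeasurable_sum _ fun k hk =>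
            (hum k j (Finset.mem_Ico.1 hk).2 hjn).mono (ℱ.mono hjm))
      rcases le_total n m with hnm | hmn
      · rw [hA.meanOscillation_eq_zero (ℱ.le m) hA0 (hsm n le_rfl hnm)]
        exact zero_le
      -- The terms with k < m are measurable at time m, hence constant on A, so only the tail
      -- oscillates.
      obtain ⟨c, hc⟩ := hA.exists_ae_eq_const (ℱ.le m) (hsm m hmn le_rfl)
      refine (meanOscillation_le_two_mul hq
        (integrable_cond ((integrable_const _).add hsumi) hA0) c).trans ?_
      have hcongr : (fun ω => ((fun _ => 1) + ∑ k ∈ Finset.Ico 0 n, u k : Ω → 𝕜) ω - c) =ᵐ[P[|A]]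
          ∑ k ∈ Finset.Ico m n, u k := by
        filter_upwards [hc] with ω hω
        rw [← hω, ← Finset.sum_Ico_consecutive u (Nat.zero_le m) hmn]
        simp only [Pi.add_apply]
        ring
      rw [eLpNorm_congr_ae hcongr]
      calc 2 * eLpNorm (∑ k ∈ Finset.Ico m n, u k) (ENNReal.ofReal p) P[|A]
          ≤ 2 * ENNReal.ofReal (K * φ (P.real A)) := by
            gcongr
            exact tail m hmn A hA hA0
        _ = _ := by
            rw [ENNReal.ofReal_mul hK0.le, ENNReal.ofReal_mul two_pos.le, ENNReal.ofReal_ofNat]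
            ring
    have h2 : ‖∫ ω, ((fun _ => 1) + ∑ k ∈ Finset.Ico 0 n, u k : Ω → 𝕜) ω ∂P‖ₑ ≤
        ENNReal.ofReal (1 + K * φ 1) := by
      have h3 := tail 0 (Nat.zero_le n) univ hF.isMeasureAtom_univ (by simp)
      rw [cond_univ, probReal_univ] at h3
      rw [ENNReal.ofReal_add zero_le_one (by positivity), ENNReal.ofReal_one]
      have h4 : ∫ ω, ((fun _ => 1) + ∑ k ∈ Finset.Ico 0 n, u k : Ω → 𝕜) ω ∂P =
          1 + ∫ ω, (∑ k ∈ Finset.Ico 0 n, u k) ω ∂P := by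
        simp only [Pi.add_apply]
        rw [integral_add (integrable_const _) hsumi]
        simp
      rw [h4]
      refine (enorm_add_le _ _).trans ?_
      rw [enorm_one]
      gcongr
      refine le_trans ?_ ((eLpNorm_le_eLpNorm_of_exponent_le hq hsumi.aestronglyMeasurable).trans h3)
      rw [eLpNorm_one_eq_lintegral_enorm]
      exact enorm_integral_le_lintegral_enorm _
    unfold campanatoNorm
    rw [ENNReal.ofReal_add (by positivity) (by positivity)]
    exact add_le_add h1 h2
  · have h1 : ∀ k ∈ Finset.Ico 0 n, ∀ᵐ ω ∂P[|D n], u k ω = (a k : 𝕜) := by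
      intro k hk
      rw [Finset.mem_Ico] at hk
      rw [ae_cond_iff_ae (hDm n le_rfl)]
      filter_upwards [measure_eq_zero_iff_ae_notMem.1
        (hD.diff_eq_zero (j := k + 1) (k := n) (by omega) le_rfl)] with ω h1 hω
      have : ω ∈ D (k + 1) := by
        by_contra h2
        exact h1 ⟨hω, h2⟩
      simp only [hu, Pi.smul_apply, indicator_of_mem this, smul_eq_mul, mul_one]
    filter_upwards [(Filter.eventually_all_finset _).2 h1] with ω hω
    simp only [Pi.add_apply, Finset.sum_apply]
    rw [Finset.sum_congr rfl fun k hk => hω k hk, ← RCLike.ofReal_sum, ha, Nat.Ico_zero_eq_range,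
      Finset.sum_range_sub (fun k => lowerStar φ (P.real (D k))),
      hF.eq_univ (hD.atom 0 (Nat.zero_le n)) (hD.pos 0 (Nat.zero_le n)), probReal_univ, lowerStar_one]
    push_cast
    ring

end TestFunctions

/-! ### Lower bounds for the operator norm -/

section Lower

variable {Ω : Type*} {m0 : MeasurableSpace Ω} {𝕜 : Type*} [RCLike 𝕜] {P : Measure Ω}
  [IsProbabilityMeasure P] {ℱ : Filtration ℕ m0} {R p : ℝ} {φ : ℝ → ℝ}

/-- Multiplication by `g` is bounded by `K` on the normed Campanato space. -/
def IsMultiplierBound (P : Measure Ω) (ℱ : Filtration ℕ m0) (p : ℝ) (φ : ℝ → ℝ) (g : Ω → 𝕜)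
    (K : ℝ≥0∞) : Prop :=
  ∀ f : Ω → 𝕜, Integrable f P → campanatoNorm P ℱ p φ f < ∞ →
    Integrable (f * g) P ∧ campanatoNorm P ℱ p φ (f * g) ≤ K * campanatoNorm P ℱ p φ f

/-- The mean of a function vanishing on a sizable set is controlled by its mean oscillation. -/
theorem eLpNorm_le_of_ae_eq_zero {q : ℝ≥0∞} (hq : 1 ≤ q) {f : Ω → 𝕜} (hf : Integrable f P)
    {A : Set Ω} (hA : MeasurableSet A) (hR : 0 ≤ R) (hAR : 1 ≤ R * P.real A)
    (hf0 : ∀ᵐ ω ∂P, ω ∈ A → f ω = 0) :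
    eLpNorm f 1 P ≤ ENNReal.ofReal (1 + R) * meanOscillation q P f := by
  set c := ∫ x, f x ∂P with hc
  have hosc : meanOscillation 1 P f ≤ meanOscillation q P f :=
    eLpNorm_le_eLpNorm_of_exponent_le hq (hf.aestronglyMeasurable.sub aestronglyMeasurable_const)
  -- On A the deviation of f from its mean c has modulus exactly |c|.
  have h1 : ‖c‖ₑ * P A ≤ meanOscillation q P f := by
    refine le_trans ?_ hosc
    unfold meanOscillation
    rw [eLpNorm_one_eq_lintegral_enorm]
    refine le_trans (le_of_eq ?_) (setLIntegral_le_lintegral A _)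
    rw [← setLIntegral_const]
    refine setLIntegral_congr_fun_ae hA ?_
    filter_upwards [hf0] with ω hω hωA
    rw [hω hωA, zero_sub, enorm_neg]
  have h2 : ‖c‖ₑ ≤ ENNReal.ofReal R * meanOscillation q P f := by
    calc ‖c‖ₑ ≤ ‖c‖ₑ * ENNReal.ofReal (R * P.real A) :=
          le_mul_of_one_le_right' (by simpa using hAR)
      _ = ENNReal.ofReal R * (‖c‖ₑ * P A) := by
          rw [ENNReal.ofReal_mul hR, ofReal_measureReal]
          ring
      _ ≤ _ := by gcongr
  calc eLpNorm f 1 P ≤ meanOscillation 1 P f + ‖c‖ₑ :=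
        eLpNorm_le_meanOscillation_add le_rfl hf.aestronglyMeasurable
    _ ≤ meanOscillation q P f + ENNReal.ofReal R * meanOscillation q P f := add_le_add hosc h2
    _ = _ := by
        rw [ENNReal.ofReal_add zero_le_one hR, ENNReal.ofReal_one]
        ring

theorem IsMultiplierBound.integrable (hp : 1 ≤ p) (hpos : ∀ r ∈ Ioc (0 : ℝ) 1, 0 < φ r)
    {g : Ω → 𝕜} {K : ℝ≥0∞} (hg : IsMultiplierBound P ℱ p φ g K) :
    Integrable g P ∧ campanatoNorm P ℱ p φ g ≤ K := by
  have h1 := campanatoNorm_one (𝕜 := 𝕜) (P := P) (ℱ := ℱ) hp hpos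
  have h := hg (fun _ => 1) (integrable_const _) (h1.trans_lt ENNReal.one_lt_top)
  have e : (fun _ => (1 : 𝕜)) * g = g := one_mul g
  rw [e] at h
  exact ⟨h.1, h.2.trans (mul_le_of_le_one_right' h1)⟩

/-- An atom agreeing with its parent inherits the parent's bound. Otherwise 1_B g vanishes on B' \
B, at least a fraction 1/R of the parent B', so its mean modulus over B' is at most a multiple of
its oscillation there, that is of K φ(P(B'))/φ(P(B)); this ratio of weights is bounded by doubling.
-/
theorem exists_eLpNorm_cond_le (hF : IsRegularAtomic P ℱ R) (hp : 1 ≤ p)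
    (hpos : ∀ r ∈ Ioc (0 : ℝ) 1, 0 < φ r) (hd : Doubling φ) (hint : IntegralCondition p φ) :
    ∃ C : ℝ, 0 < C ∧ ∀ (g : Ω → 𝕜) (K : ℝ≥0∞), IsMultiplierBound P ℱ p φ g K →
      ∀ n B, IsMeasureAtom P (ℱ n) B → 0 < P B → eLpNorm g 1 P[|B] ≤ ENNReal.ofReal C * K := by
  have hR := hF.two_le
  have hR0 : 0 < R := by linarith
  obtain ⟨C, hC, hind⟩ := exists_campanatoNorm_indicator_le (𝕜 := 𝕜) (P := P) (ℱ := ℱ)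
    hp hpos hd hint
  obtain ⟨D, hD, hcomp⟩ := hd.exists_comparable hpos R
  have hφ1 := hpos 1 (by simp)
  have hq : 1 ≤ ENNReal.ofReal p := by simpa using hp
  have hD0 : 0 < D := by linarith
  -- The first summand serves the root, the second the strictly smaller children; no loss
  -- accumulates over generations.
  refine ⟨(φ 1 + 1) + R * ((1 + R) * (D * C)), by positivity, fun g K hg n => ?_⟩
  obtain ⟨hgi, hgK⟩ := hg.integrable hp hpos
  induction n with
  | zero =>
    intro B hB h0
    rw [hF.eq_univ hB h0, cond_univ]
    refine (eLpNorm_one_le_campanatoNorm hF hp hφ1 hgi).trans ?_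
    have : 0 < R * ((1 + R) * (D * C)) := by positivity
    exact mul_le_mul' (ENNReal.ofReal_le_ofReal (by linarith)) hgK
  | succ n ih =>
    intro B hB h0
    obtain ⟨B', hB', h0', hdiff, hle, hle'⟩ := hF.exists_parent hB h0
    rcases hF.ae_eq_or_le hB hB' hdiff with h | h
    · rw [cond_congr h]
      exact ih B' hB' h0'
    have : IsProbabilityMeasure P[|B'] := cond_isProbabilityMeasure h0'.ne'
    have hBm := ℱ.le _ _ hB.1
    have hB'm := ℱ.le _ _ hB'.1
    have hb := measureReal_mem_Ioc h0
    have hb' := measureReal_mem_Ioc h0'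
    have hφ := hpos _ hb
    have hφ' := hpos _ hb'
    have hN := hind _ B hB h0
    obtain ⟨hi, hbd⟩ := hg (B.indicator fun _ => 1) ((integrable_const _).indicator hBm)
      (hN.trans_lt ENNReal.ofReal_lt_top)
    set f : Ω → 𝕜 := (B.indicator fun _ => 1) * g with hf
    have hosc : meanOscillation (ENNReal.ofReal p) P[|B'] f ≤ ENNReal.ofReal (D * C) * K := by
      calc meanOscillation (ENNReal.ofReal p) P[|B'] f
          ≤ ENNReal.ofReal (φ (P.real B')) * campanatoSeminorm P ℱ p φ f :=
            meanOscillation_le_seminorm hp hi hB' h0' hφ'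
        _ ≤ ENNReal.ofReal (φ (P.real B')) * (K * ENNReal.ofReal (C / φ (P.real B))) := by
            gcongr
            refine le_self_add.trans (hbd.trans ?_)
            gcongr
        _ = ENNReal.ofReal (φ (P.real B') * (C / φ (P.real B))) * K := by
            rw [ENNReal.ofReal_mul hφ'.le]
            ring
        _ ≤ _ := by
            refine mul_le_mul_left (ENNReal.ofReal_le_ofReal ?_) _
            rw [mul_div_assoc', div_le_iff₀ hφ]
            have := mul_le_mul_of_nonneg_left (hcomp _ hb _ hb' hle hle').2 hC.le
            linarith
    have hA : 1 ≤ R * P[|B'].real (B' \ B) := by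
      rw [measureReal_def, cond_apply hB'm, inter_eq_right.2 sdiff_subset, ENNReal.toReal_mul,
        ENNReal.toReal_inv, ← measureReal_def, ← measureReal_def, mul_left_comm,
        ← div_eq_inv_mul, one_le_div hb'.1]
      exact h
    have hmean : eLpNorm f 1 P[|B'] ≤ ENNReal.ofReal (1 + R) * (ENNReal.ofReal (D * C) * K) := by
      refine (eLpNorm_le_of_ae_eq_zero hq (integrable_cond hi h0') (hB'm.diff hBm) hR0.le hA
        (Filter.Eventually.of_forall fun ω hω => ?_)).trans (by gcongr)
      simp [hf, hω.2]
    have hgf : g =ᵐ[P[|B]] f := by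
      refine (ae_cond_iff_ae hBm).2 (Filter.Eventually.of_forall fun ω hω => ?_)
      simp [hf, hω]
    calc eLpNorm g 1 P[|B] = eLpNorm f 1 P[|B] := eLpNorm_congr_ae hgf
      _ ≤ eLpNorm f 1 (ENNReal.ofReal R • P[|B']) :=
          eLpNorm_mono_measure _ (cond_le_smul_cond hR0 h0 hdiff hle')
      _ = ENNReal.ofReal R * eLpNorm f 1 P[|B'] := by
          rw [eLpNorm_smul_measure_of_ne_top ENNReal.one_ne_top]
          simp
      _ ≤ ENNReal.ofReal R * (ENNReal.ofReal (1 + R) * (ENNReal.ofReal (D * C) * K)) := by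
          gcongr
      _ = ENNReal.ofReal (R * ((1 + R) * (D * C))) * K := by
          rw [ENNReal.ofReal_mul hR0.le, ENNReal.ofReal_mul (p := 1 + R) (by positivity)]
          ring
      _ ≤ _ := by
          gcongr
          linarith

/-- The conditional expectations of |g| are its means on atoms, hence at most K, and they converge
almost everywhere to |g| because the filtration generates the whole σ-algebra. -/
theorem eLpNorm_top_le_of_forall_atom (hF : IsRegularAtomic P ℱ R) (hgen : (⨆ n, ℱ n) = m0)
    {g : Ω → 𝕜} (hg : Integrable g P) {K : ℝ≥0∞}
    (h : ∀ n B, IsMeasureAtom P (ℱ n) B → 0 < P B → eLpNorm g 1 P[|B] ≤ K) :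
    eLpNorm g ∞ P ≤ K := by
  rcases eq_or_ne K ∞ with rfl | hK
  · exact le_top
  have hbd : ∀ n, ∀ᵐ ω ∂P, (P[fun ω => ‖g ω‖ | ℱ n]) ω ≤ K.toReal := by
    intro n
    by_contra hcon
    obtain ⟨B, hB, hpos⟩ := hF.exists_atom n _ (pos_iff_ne_zero.2 hcon)
    have hB0 : 0 < P B := hpos.trans_le (measure_mono inter_subset_right)
    have hae := (ae_cond_iff_ae (ℱ.le _ _ hB.1)).1 (hB.condExp_ae_eq (ℱ.le n) hB0 hg.norm)
    refine hpos.ne' (measure_eq_zero_iff_ae_notMem.2 ?_)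
    filter_upwards [hae] with ω hω hωB
    refine hωB.1 ?_
    have h1 := h n B hB hB0
    rw [eLpNorm_one_eq_lintegral_enorm] at h1
    show (P[fun ω => ‖g ω‖ | ℱ n]) ω ≤ K.toReal
    rw [hω hωB.2]
    rw [integral_norm_eq_lintegral_enorm (integrable_cond hg hB0).aestronglyMeasurable]
    exact ENNReal.toReal_mono hK h1
  have hlim := tendsto_ae_condExp (ℱ := ℱ) (μ := P) fun ω => ‖g ω‖
  have hm : (⨆ n, (ℱ n : MeasurableSpace Ω)) ≤ m0 := hgen.le
  have hself : P[fun ω => ‖g ω‖ | ⨆ n, ℱ n] =ᵐ[P] fun ω => ‖g ω‖ := by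
    refine condExp_of_aestronglyMeasurable' hm ?_ hg.norm
    rw [hgen]
    exact hg.norm.aestronglyMeasurable
  rw [eLpNorm_exponent_top]
  refine (eLpNormEssSup_le_of_ae_bound (C := K.toReal) ?_).trans ENNReal.ofReal_toReal_le
  filter_upwards [hlim, hself, ae_all_iff.2 hbd] with ω h1 h2 h3
  rw [h2] at h1
  exact le_of_tendsto' h1 h3

/-- For the test function f of the atom B, fg equals φ_*(P(B)) g on B, so its oscillation there is
φ_*(P(B)) times that of g. -/
theorem exists_seminorm_le_of_isMultiplierBound (hF : IsRegularAtomic P ℱ R) (hp : 1 ≤ p)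
    (hpos : ∀ r ∈ Ioc (0 : ℝ) 1, 0 < φ r)
    (hmeas : AEMeasurable φ (volume.restrict (Ioc (0 : ℝ) 1)))
    (hd : Doubling φ) (hint : IntegralCondition p φ) :
    ∃ C : ℝ, 0 < C ∧ ∀ (g : Ω → 𝕜) (K : ℝ≥0∞), IsMultiplierBound P ℱ p φ g K →
      campanatoSeminorm P ℱ p (fun r => φ r / lowerStar φ r) g ≤ ENNReal.ofReal C * K := by
  obtain ⟨C, hC, htest⟩ := exists_test_function (𝕜 := 𝕜) hF hp hpos hmeas hd hint
  refine ⟨C, hC, fun g K hg => ?_⟩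
  have hls : ∀ r ∈ Ioc (0 : ℝ) 1, 0 < lowerStar φ r := fun r hr =>
    zero_lt_one.trans_le (one_le_lowerStar hpos hmeas hd hr)
  refine campanatoSeminorm_le hp (hg.integrable hp hpos).1
    (fun r hr => div_pos (hpos r hr) (hls r hr)) fun n B hB h0 => ?_
  have hb := measureReal_mem_Ioc h0
  have hφ := hpos _ hb
  have hs := hls _ hb
  obtain ⟨f, hfi, hfC, hfB⟩ := htest n B hB h0
  obtain ⟨hi, hbd⟩ := hg f hfi (hfC.trans_lt ENNReal.ofReal_lt_top)
  have h1 : meanOscillation (ENNReal.ofReal p) P[|B] (f * g) =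
      ENNReal.ofReal (lowerStar φ (P.real B)) * meanOscillation (ENNReal.ofReal p) P[|B] g := by
    have e : f * g =ᵐ[P[|B]] fun ω => (lowerStar φ (P.real B) : 𝕜) * g ω := by
      filter_upwards [hfB] with ω hω
      simp [hω]
    rw [meanOscillation_congr e, meanOscillation_const_mul, ← ofReal_norm, RCLike.norm_ofReal,
      abs_of_pos hs]
  have h2 : ENNReal.ofReal (lowerStar φ (P.real B)) *
      meanOscillation (ENNReal.ofReal p) P[|B] g ≤
        ENNReal.ofReal (φ (P.real B)) * (ENNReal.ofReal C * K) := by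
    rw [← h1]
    refine (meanOscillation_le_seminorm hp hi hB h0 hφ).trans ?_
    gcongr
    refine le_self_add.trans (hbd.trans ?_)
    rw [mul_comm]
    gcongr
  rw [ENNReal.ofReal_div_of_pos hs, ENNReal.div_eq_inv_mul, mul_assoc,
    ← ENNReal.mul_le_iff_le_inv (by simpa using hs) ENNReal.ofReal_ne_top]
  exact h2

end Lower

/-! ### Closed graph theorem and automatic boundedness of multipliers -/

open Filter Topology

/-- The closed graph theorem for a complete norm given as a function. -/
theorem exists_bound_of_closed_graph {𝕜 V : Type*} [RCLike 𝕜] [AddCommGroup V] [Module 𝕜 V]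
    (N : V → ℝ) (hnonneg : ∀ x, 0 ≤ N x) (hsmul : ∀ (c : 𝕜) x, N (c • x) = ‖c‖ * N x)
    (hadd : ∀ x y, N (x + y) ≤ N x + N y) (hzero : ∀ x, N x = 0 → x = 0)
    (hcomplete : ∀ u : ℕ → V, (∀ ε > 0, ∃ n₀, ∀ m ≥ n₀, ∀ n ≥ n₀, N (u m - u n) < ε) →
      ∃ x, Tendsto (fun m => N (u m - x)) atTop (𝓝 0))
    (T : V →ₗ[𝕜] V)
    (hclosed : ∀ (u : ℕ → V) (x y : V), Tendsto (fun m => N (u m - x)) atTop (𝓝 0) →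
      Tendsto (fun m => N (T (u m) - y)) atTop (𝓝 0) → y = T x) :
    ∃ C : ℝ, 0 ≤ C ∧ ∀ x, N (T x) ≤ C * N x := by
  -- V carries no norm of its own here, so N can be installed as one; the intended V is a subspace
  -- of L^1, which already has a different norm.
  let _ : Norm V := ⟨N⟩
  have core : NormedSpace.Core 𝕜 V :=
    { norm_nonneg := hnonneg
      norm_smul := hsmul
      norm_triangle := hadd
      norm_eq_zero_iff := fun x => ⟨hzero x, fun h => by
        have := hsmul 0 x
        rw [zero_smul, norm_zero, zero_mul] at this
        rw [h]
        exact this⟩ }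
  let _ : NormedAddCommGroup V := NormedAddCommGroup.ofCore core
  let _ : NormedSpace 𝕜 V := NormedSpace.ofCore core
  have hnorm : ∀ x : V, ‖x‖ = N x := fun _ => rfl
  have hdist : ∀ x y : V, dist x y = N (x - y) := fun x y => by rw [dist_eq_norm, hnorm]
  have : CompleteSpace V := by
    refine Metric.complete_of_cauchySeq_tendsto fun u hu => ?_
    rw [Metric.cauchySeq_iff] at hu
    simp only [hdist] at hu
    obtain ⟨x, hx⟩ := hcomplete u hu
    refine ⟨x, tendsto_iff_dist_tendsto_zero.2 ?_⟩
    simpa only [hdist] using hx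
  have hcont : Continuous T := T.continuous_of_seq_closed_graph fun u x y hu hy => by
    rw [tendsto_iff_dist_tendsto_zero] at hu hy
    simp only [hdist] at hu hy
    exact hclosed u x y hu hy
  let T' : V →L[𝕜] V := ⟨T, hcont⟩
  exact ⟨‖T'‖, norm_nonneg _, fun x => T'.le_opNorm x⟩

section NormProperties

variable {Ω : Type*} {m0 : MeasurableSpace Ω} {𝕜 : Type*} [RCLike 𝕜] {P : Measure Ω}
  {ℱ : Filtration ℕ m0} {R p : ℝ} {φ : ℝ → ℝ} {f g : Ω → 𝕜}

theorem campanatoNorm_congr (h : f =ᵐ[P] g) :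
    campanatoNorm P ℱ p φ f = campanatoNorm P ℱ p φ g := by
  unfold campanatoNorm campanatoSeminorm
  rw [integral_congr_ae h]
  congr 1
  refine iSup_congr fun n => iSup_congr fun B => iSup_congr fun _ => iSup_congr fun _ => ?_
  congr 3
  refine lintegral_congr_ae (ae_restrict_of_ae ?_)
  filter_upwards [h, condExp_congr_ae (m := ℱ n) h] with ω h1 h2
  rw [h1, h2]

variable [IsProbabilityMeasure P]

theorem campanatoNorm_add_le (hp : 1 ≤ p) (hf : Integrable f P) (hg : Integrable g P) :
    campanatoNorm P ℱ p φ (f + g) ≤ campanatoNorm P ℱ p φ f + campanatoNorm P ℱ p φ g := by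
  have h1 : campanatoSeminorm P ℱ p φ (f + g) ≤
      campanatoSeminorm P ℱ p φ f + campanatoSeminorm P ℱ p φ g := by
    refine iSup₂_le fun n B => iSup₂_le fun hB h0 => ?_
    rw [campanato_term_eq hp (hf.add hg) hB h0]
    refine le_trans ?_ (add_le_add (inv_mul_meanOscillation_le hp hf hB h0)
      (inv_mul_meanOscillation_le hp hg hB h0))
    rw [← mul_add]
    gcongr
    exact meanOscillation_add_le (by simpa using hp) (integrable_cond hf h0) (integrable_cond hg h0)
  have h2 : ‖∫ ω, (f + g) ω ∂P‖ₑ ≤ ‖∫ ω, f ω ∂P‖ₑ + ‖∫ ω, g ω ∂P‖ₑ := by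
    simp only [Pi.add_apply]
    rw [integral_add hf hg]
    exact enorm_add_le _ _
  calc campanatoNorm P ℱ p φ (f + g) ≤ _ := add_le_add h1 h2
    _ = _ := add_add_add_comm _ _ _ _

theorem campanatoNorm_const_smul (hp : 1 ≤ p) (hf : Integrable f P) (c : 𝕜) :
    campanatoNorm P ℱ p φ (c • f) = ‖c‖ₑ * campanatoNorm P ℱ p φ f := by
  unfold campanatoNorm
  rw [mul_add]
  congr 1
  · unfold campanatoSeminorm
    simp only [ENNReal.mul_iSup]
    refine iSup_congr fun n => iSup_congr fun B => iSup_congr fun hB => iSup_congr fun h0 => ?_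
    rw [campanato_term_eq hp (hf.smul c) hB h0, campanato_term_eq hp hf hB h0, mul_left_comm]
    congr 1
    exact meanOscillation_const_mul c f
  · simp only [Pi.smul_apply]
    rw [integral_smul, enorm_smul]

/-- Fatou's lemma along an almost everywhere convergent subsequence. Seminorm and mean are each
bounded by K separately, hence the factor 2, which is harmless for proving completeness. -/
theorem campanatoNorm_le_of_tendsto (hp : 1 ≤ p) (hpos : ∀ r ∈ Ioc (0 : ℝ) 1, 0 < φ r)
    {u : ℕ → Ω → 𝕜} (hu : ∀ k, Integrable (u k) P)
    (hf : Integrable f P) (hlim : Tendsto (fun k => eLpNorm (u k - f) 1 P) atTop (𝓝 0))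
    {K : ℝ≥0∞} (hK : ∀ᶠ k in atTop, campanatoNorm P ℱ p φ (u k) ≤ K) :
    campanatoNorm P ℱ p φ f ≤ 2 * K := by
  obtain ⟨ns, hns, hae⟩ := (tendstoInMeasure_of_tendsto_eLpNorm one_ne_zero
    (fun k => (hu k).aestronglyMeasurable) hf.aestronglyMeasurable hlim).exists_seq_tendsto_ae
  have hK' := hns.tendsto_atTop.eventually hK
  have hset : ∀ B : Set Ω, Tendsto (fun k => ∫ ω in B, u k ω ∂P) atTop (𝓝 (∫ ω in B, f ω ∂P)) :=
    fun B => tendsto_setIntegral_of_L1' f hf.aestronglyMeasurable (Eventually.of_forall hu) hlim B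
  have h1 : campanatoSeminorm P ℱ p φ f ≤ K := by
    refine campanatoSeminorm_le hp hf hpos fun n B hB h0 => ?_
    have hint : Tendsto (fun k => ∫ ω, u (ns k) ω ∂P[|B]) atTop (𝓝 (∫ ω, f ω ∂P[|B])) := by
      simp only [integral_cond]
      exact ((hset B).comp hns.tendsto_atTop).const_smul _
    have hl := meanOscillation_le_liminf (q := ENNReal.ofReal p) (ν := P[|B])
      (u := fun k => u (ns k))
      (fun k => (integrable_cond (hu (ns k)) h0).aestronglyMeasurable)
      (cond_absolutelyContinuous.ae_le hae) hint
    refine hl.trans (liminf_le_of_frequently_le' (hK'.mono fun k hk => ?_).frequently)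
    refine (meanOscillation_le_seminorm hp (hu _) hB h0 (hpos _ (measureReal_mem_Ioc h0))).trans ?_
    gcongr
    exact le_self_add.trans hk
  have h2 : ‖∫ ω, f ω ∂P‖ₑ ≤ K := by
    have h3 := hset univ
    simp only [Measure.restrict_univ] at h3
    refine le_of_tendsto (h3.enorm) (hK.mono fun k hk => ?_)
    exact le_add_self.trans hk
  calc campanatoNorm P ℱ p φ f ≤ K + K := add_le_add h1 h2
    _ = _ := (two_mul K).symm

end NormProperties

section Bounded

variable {Ω : Type*} {m0 : MeasurableSpace Ω} {𝕜 : Type*} [RCLike 𝕜] {P : Measure Ω}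
  [IsProbabilityMeasure P] {ℱ : Filtration ℕ m0} {R p : ℝ} {φ : ℝ → ℝ}

/-- The classes in `L_1` with finite Campanato norm. -/
noncomputable def campanatoSubmodule (𝕜 : Type*) [RCLike 𝕜] (P : Measure Ω)
    [IsProbabilityMeasure P] (ℱ : Filtration ℕ m0) (φ : ℝ → ℝ) (hp : 1 ≤ p) :
    Submodule 𝕜 (Lp 𝕜 1 P) where
  carrier := {f | campanatoNorm P ℱ p φ f < ∞}
  add_mem' {f g} hf hg := by
    rw [mem_ofPred_eq, campanatoNorm_congr (Lp.coeFn_add f g)]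
    exact (campanatoNorm_add_le hp (L1.integrable_coeFn f) (L1.integrable_coeFn g)).trans_lt
      (ENNReal.add_lt_top.2 ⟨hf, hg⟩)
  zero_mem' := by
    have : campanatoNorm P ℱ p φ ((0 : 𝕜) • fun _ : Ω => (0 : 𝕜)) = 0 := by
      rw [campanatoNorm_const_smul hp (integrable_const _)]
      simp
    rw [mem_ofPred_eq, campanatoNorm_congr (g := (0 : 𝕜) • fun _ : Ω => (0 : 𝕜))
      ((Lp.coeFn_zero 𝕜 1 P).trans (by simp)), this]
    exact ENNReal.zero_lt_top
  smul_mem' c f hf := by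
    rw [mem_ofPred_eq, campanatoNorm_congr (Lp.coeFn_smul c f),
      campanatoNorm_const_smul hp (L1.integrable_coeFn f)]
    exact ENNReal.mul_lt_top enorm_lt_top hf

/-- The space is complete: a Cauchy sequence has an L^1 limit, and lower semicontinuity upgrades the
convergence. The graph of multiplication is closed because norm convergence gives almost everywhere
convergence of a subsequence. -/
theorem exists_isMultiplierBound (hF : IsRegularAtomic P ℱ R) (hp : 1 ≤ p)
    (hpos : ∀ r ∈ Ioc (0 : ℝ) 1, 0 < φ r) {g : Ω → 𝕜}
    (hg : g ∈ pointwiseMultipliers P (normedCampanatoSpace 𝕜 P ℱ p φ)) :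
    ∃ C : ℝ, 0 ≤ C ∧ IsMultiplierBound P ℱ p φ g (ENNReal.ofReal C) := by
  have hφ1 := hpos 1 (by simp)
  set X := campanatoSubmodule 𝕜 P ℱ φ hp with hX
  set N : X → ℝ := fun x => (campanatoNorm P ℱ p φ (x : Lp 𝕜 1 P)).toReal with hN
  have hfin : ∀ x : X, campanatoNorm P ℱ p φ (x : Lp 𝕜 1 P) < ∞ := fun x => x.2
  have hofReal : ∀ x : X, ENNReal.ofReal (N x) = campanatoNorm P ℱ p φ (x : Lp 𝕜 1 P) := fun x =>
    ENNReal.ofReal_toReal (hfin x).ne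
  have hi : ∀ x : Lp 𝕜 1 P, Integrable x P := fun x => L1.integrable_coeFn x
  have hL1 : ∀ x : X, ‖(x : Lp 𝕜 1 P)‖ ≤ (φ 1 + 1) * N x := fun x => by
    rw [Lp.norm_def]
    refine ENNReal.toReal_le_of_le_ofReal (mul_nonneg (by linarith) ENNReal.toReal_nonneg) ?_
    rw [ENNReal.ofReal_mul (by linarith), hofReal]
    exact eLpNorm_one_le_campanatoNorm hF hp hφ1 (hi x)
  have hL1lim : ∀ (u : ℕ → X) (x : X), Tendsto (fun m => N (u m - x)) atTop (𝓝 0) →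
      TendstoInMeasure P (fun m => ⇑(u m : Lp 𝕜 1 P)) atTop (x : Lp 𝕜 1 P) := by
    intro u x h
    refine tendstoInMeasure_of_tendsto_Lp (p := 1) (tendsto_iff_norm_sub_tendsto_zero.2 ?_)
    refine squeeze_zero (fun _ => norm_nonneg _) (fun m => hL1 (u m - x)) ?_
    simpa using h.const_mul (φ 1 + 1)
  have hmem : ∀ x : X, MemLp (⇑(x : Lp 𝕜 1 P) * g) 1 P ∧
      campanatoNorm P ℱ p φ (⇑(x : Lp 𝕜 1 P) * g) < ∞ := fun x =>
    hg.2 _ ⟨Lp.memLp _, hfin x⟩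
  let T : X →ₗ[𝕜] X :=
    { toFun := fun x => ⟨(hmem x).1.toLp, by
        show campanatoNorm P ℱ p φ _ < ∞
        rw [campanatoNorm_congr (hmem x).1.coeFn_toLp]
        exact (hmem x).2⟩
      map_add' := fun x y => by
        ext1
        refine Lp.ext ?_
        filter_upwards [(hmem (x + y)).1.coeFn_toLp, (hmem x).1.coeFn_toLp, (hmem y).1.coeFn_toLp,
          Lp.coeFn_add (x : Lp 𝕜 1 P) y, Lp.coeFn_add (hmem x).1.toLp (hmem y).1.toLp]
          with ω h1 h2 h3 h4 h5
        refine h1.trans (Eq.trans ?_ h5.symm)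
        simp only [Pi.mul_apply, Pi.add_apply, Submodule.coe_add] at h2 h3 h4 ⊢
        rw [h4, h2, h3, add_mul]
      map_smul' := fun c x => by
        ext1
        refine Lp.ext ?_
        filter_upwards [(hmem (c • x)).1.coeFn_toLp, (hmem x).1.coeFn_toLp,
          Lp.coeFn_smul c (x : Lp 𝕜 1 P), Lp.coeFn_smul c (hmem x).1.toLp] with ω h1 h2 h3 h4
        refine h1.trans (Eq.trans ?_ h4.symm)
        simp only [Pi.mul_apply, Pi.smul_apply, Submodule.coe_smul, smul_eq_mul] at h2 h3 ⊢
        rw [h3, h2, mul_assoc] }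
  have hT : ∀ x : X, ⇑(T x : Lp 𝕜 1 P) =ᵐ[P] ⇑(x : Lp 𝕜 1 P) * g := fun x =>
    (hmem x).1.coeFn_toLp
  obtain ⟨C, hC, hbound⟩ := exists_bound_of_closed_graph (𝕜 := 𝕜) N
    (fun _ => ENNReal.toReal_nonneg)
    (fun c x => by
      simp only [hN]
      rw [Submodule.coe_smul, campanatoNorm_congr (Lp.coeFn_smul c (x : Lp 𝕜 1 P)),
        campanatoNorm_const_smul hp (hi x), ENNReal.toReal_mul, toReal_enorm])
    (fun x y => by
      simp only [hN]
      rw [← ENNReal.toReal_add (hfin x).ne (hfin y).ne, Submodule.coe_add,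
        campanatoNorm_congr (Lp.coeFn_add (x : Lp 𝕜 1 P) y)]
      exact ENNReal.toReal_mono (ENNReal.add_lt_top.2 ⟨hfin x, hfin y⟩).ne
        (campanatoNorm_add_le hp (hi x) (hi y)))
    (fun x hx => by
      have := hL1 x
      rw [hx, mul_zero] at this
      exact Subtype.ext (norm_le_zero_iff.1 this))
    (fun u hu => by
      have hcau : CauchySeq fun k => (u k : Lp 𝕜 1 P) := by
        rw [Metric.cauchySeq_iff]
        intro ε hε
        obtain ⟨n₀, h⟩ := hu (ε / (φ 1 + 1)) (by positivity)
        refine ⟨n₀, fun m hm n hn => ?_⟩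
        rw [dist_eq_norm]
        refine (hL1 (u m - u n)).trans_lt ?_
        rw [mul_comm, ← lt_div_iff₀ (by linarith)]
        exact h m hm n hn
      obtain ⟨x, hx⟩ := cauchySeq_tendsto_of_complete hcau
      have hkey : ∀ ε > 0, ∃ n₀, ∀ m ≥ n₀,
          campanatoNorm P ℱ p φ ((u m : Lp 𝕜 1 P) - x : Lp 𝕜 1 P) ≤ 2 * ENNReal.ofReal ε := by
        intro ε hε
        obtain ⟨n₀, h⟩ := hu ε hε
        refine ⟨n₀, fun m hm => campanatoNorm_le_of_tendsto hp hpos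
          (u := fun n => ((u m : Lp 𝕜 1 P) - (u n : Lp 𝕜 1 P) : Lp 𝕜 1 P)) (fun n => hi _) (hi _)
          ((Lp.tendsto_Lp_iff_tendsto_eLpNorm' _ _).1 (hx.const_sub _)) ?_⟩
        filter_upwards [eventually_ge_atTop n₀] with n hn
        have h2 := ENNReal.ofReal_le_ofReal (h m hm n hn).le
        rwa [hofReal] at h2
      have hxX : x ∈ X := by
        obtain ⟨n₀, h⟩ := hkey 1 one_pos
        have h1 : (u n₀ : Lp 𝕜 1 P) - x ∈ X :=
          (h n₀ le_rfl).trans_lt (ENNReal.mul_lt_top (by simp) ENNReal.ofReal_lt_top)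
        simpa using X.sub_mem (u n₀).2 h1
      refine ⟨⟨x, hxX⟩, Metric.tendsto_atTop.2 fun ε hε => ?_⟩
      obtain ⟨n₀, h⟩ := hkey (ε / 3) (by positivity)
      refine ⟨n₀, fun m hm => ?_⟩
      rw [Real.dist_0_eq_abs, abs_of_nonneg ENNReal.toReal_nonneg]
      have h1 : N (u m - ⟨x, hxX⟩) ≤ 2 * (ε / 3) := by
        refine ENNReal.toReal_le_of_le_ofReal (by positivity) ?_
        rw [ENNReal.ofReal_mul two_pos.le, ENNReal.ofReal_ofNat]
        exact h m hm
      linarith)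
    T
    -- A second subsequence is extracted from the first, so that both u and its images converge
    -- almost everywhere.
    (fun u x y hx hy => by
      obtain ⟨ns, hns, h1⟩ := (hL1lim u x hx).exists_seq_tendsto_ae
      obtain ⟨ms, hms, h2⟩ :=
        (hL1lim (fun k => T (u (ns k))) y (hy.comp hns.tendsto_atTop)).exists_seq_tendsto_ae
      refine Subtype.ext (Lp.ext ?_)
      filter_upwards [h1, h2, hT x, ae_all_iff.2 fun k => hT (u k)] with ω h1 h2 h3 h4
      rw [h3]
      refine tendsto_nhds_unique h2 ?_
      simp only [h4, Pi.mul_apply]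
      exact (h1.comp hms.tendsto_atTop).mul_const _)
  refine ⟨C, hC, fun f hf hfN => ?_⟩
  have hfL := memLp_one_iff_integrable.2 hf
  refine ⟨memLp_one_iff_integrable.1 (hg.2 f ⟨hfL, hfN⟩).1, ?_⟩
  have hx : campanatoNorm P ℱ p φ hfL.toLp < ∞ := by
    rwa [campanatoNorm_congr hfL.coeFn_toLp]
  have h1 := ENNReal.ofReal_le_ofReal (hbound ⟨hfL.toLp, hx⟩)
  rw [ENNReal.ofReal_mul hC, hofReal, hofReal, campanatoNorm_congr (hT _),
    campanatoNorm_congr hfL.coeFn_toLp,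
    campanatoNorm_congr (hfL.coeFn_toLp.mul (ae_eq_refl g))] at h1
  exact h1

end Bounded

/-! ### The operator norm and the conclusion -/

section Main

variable {Ω : Type*} {m0 : MeasurableSpace Ω} {𝕜 : Type*} [RCLike 𝕜] {P : Measure Ω}
  [IsProbabilityMeasure P] {ℱ : Filtration ℕ m0} {R p : ℝ} {φ : ℝ → ℝ}

/-- The supremum omits functions vanishing almost everywhere, for which both sides are 0. For all
others the norm is nonzero by the L^1 embedding, so the quotient can be cleared. -/
theorem isMultiplierBound_multiplierNorm (hF : IsRegularAtomic P ℱ R) (hp : 1 ≤ p)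
    (hφ1 : 0 < φ 1) {g : Ω → 𝕜}
    (hg : g ∈ pointwiseMultipliers P (normedCampanatoSpace 𝕜 P ℱ p φ)) :
    IsMultiplierBound P ℱ p φ g (multiplierNorm P ℱ p φ g) := by
  intro f hf hfN
  have hfX : f ∈ normedCampanatoSpace 𝕜 P ℱ p φ := ⟨memLp_one_iff_integrable.2 hf, hfN⟩
  refine ⟨memLp_one_iff_integrable.1 (hg.2 f hfX).1, ?_⟩
  by_cases h0 : f =ᵐ[P] 0
  · have h1 : f * g =ᵐ[P] f := by
      filter_upwards [h0] with ω hω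
      simp [hω]
    have h2 : campanatoNorm P ℱ p φ f = 0 := by
      have h3 := campanatoNorm_const_smul (ℱ := ℱ) (φ := φ) hp hf (0 : 𝕜)
      rw [enorm_zero, zero_mul, zero_smul] at h3
      rwa [campanatoNorm_congr h0]
    rw [campanatoNorm_congr h1, h2]
    simp
  · have hne : campanatoNorm P ℱ p φ f ≠ 0 := by
      intro h
      have h1 := eLpNorm_one_le_campanatoNorm hF hp hφ1 hf
      rw [h, mul_zero, nonpos_iff_eq_zero, eLpNorm_eq_zero_iff hf.aestronglyMeasurable
        one_ne_zero] at h1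
      exact h0 h1
    rw [← ENNReal.div_le_iff hne hfN.ne]
    exact le_iSup₂_of_le f hfX (le_iSup_of_le h0 le_rfl)

omit [IsProbabilityMeasure P] in
theorem IsMultiplierBound.multiplierNorm_le {g : Ω → 𝕜} {K : ℝ≥0∞}
    (hg : IsMultiplierBound P ℱ p φ g K) : multiplierNorm P ℱ p φ g ≤ K :=
  iSup₂_le fun f hf => iSup_le fun _ =>
    ENNReal.div_le_of_le_mul (hg f (memLp_one_iff_integrable.1 hf.1) hf.2).2

end Main

end MartingaleCampanato

theorem theorem1p1 {Ω : Type*} {m0 : MeasurableSpace Ω} {𝕜 : Type*} [RCLike 𝕜]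
    (P : Measure Ω) [IsProbabilityMeasure P] (ℱ : Filtration ℕ m0)
    (hgen : (⨆ n, ℱ n) = m0)
    (hatoms : ∀ n, MartingaleCampanato.GeneratedByCountableAtoms P (ℱ n))
    (hzero : ℱ 0 = ⊥)
    (hreg : MartingaleCampanato.IsRegular P ℱ)
    (p : ℝ) (hp : 1 ≤ p)
    (φ : ℝ → ℝ) (hφpos : ∀ r ∈ Ioc (0 : ℝ) 1, 0 < φ r)
    (hφmeas : AEMeasurable φ (volume.restrict (Ioc (0 : ℝ) 1)))
    (hdoubling : MartingaleCampanato.Doubling φ)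
    (hint : MartingaleCampanato.IntegralCondition p φ) :
    MartingaleCampanato.pointwiseMultipliers P
        (MartingaleCampanato.normedCampanatoSpace 𝕜 P ℱ p φ) =
      MartingaleCampanato.campanatoSpace 𝕜 P ℱ p
          (fun r => φ r / MartingaleCampanato.lowerStar φ r) ∩
        {g | MemLp g ∞ P} ∧
    ∃ C : ℝ, 0 < C ∧
      ∀ g ∈ MartingaleCampanato.pointwiseMultipliers P
          (MartingaleCampanato.normedCampanatoSpace 𝕜 P ℱ p φ),
        MartingaleCampanato.multiplierNorm P ℱ p φ g ≤
          ENNReal.ofReal C *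
            (MartingaleCampanato.campanatoSeminorm P ℱ p
              (fun r => φ r / MartingaleCampanato.lowerStar φ r) g + eLpNorm g ∞ P) ∧
        MartingaleCampanato.campanatoSeminorm P ℱ p
              (fun r => φ r / MartingaleCampanato.lowerStar φ r) g + eLpNorm g ∞ P ≤
          ENNReal.ofReal C * MartingaleCampanato.multiplierNorm P ℱ p φ g := by

  open MartingaleCampanato in
  obtain ⟨R, hF⟩ := hreg.exists_isRegularAtomic hatoms hzero
  have hφ1 := hφpos 1 (by simp)
  obtain ⟨C₁, hC₁, hup⟩ := exists_campanatoNorm_mul_le (𝕜 := 𝕜) hF hp hφpos hφmeas hdoubling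
  obtain ⟨C₂, hC₂, havg⟩ := exists_eLpNorm_cond_le (𝕜 := 𝕜) hF hp hφpos hdoubling hint
  obtain ⟨C₃, hC₃, hsemi⟩ :=
    exists_seminorm_le_of_isMultiplierBound (𝕜 := 𝕜) hF hp hφpos hφmeas hdoubling hint
  have htop : ∀ (g : Ω → 𝕜) (K : ℝ≥0∞), IsMultiplierBound P ℱ p φ g K →
      eLpNorm g ∞ P ≤ ENNReal.ofReal C₂ * K := fun g K hg =>
    eLpNorm_top_le_of_forall_atom hF hgen (hg.integrable hp hφpos).1 (havg g K hg)
  -- The closed graph theorem supplies some finite bound, which gives membership. The final lower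
  -- estimate instead takes the operator norm itself as the bound K.
  have hsub : ∀ g ∈ pointwiseMultipliers P (normedCampanatoSpace 𝕜 P ℱ p φ),
      Integrable g P ∧ MemLp g ∞ P ∧
        campanatoSeminorm P ℱ p (fun r => φ r / lowerStar φ r) g < ∞ := by
    intro g hg
    obtain ⟨C, -, hb⟩ := exists_isMultiplierBound hF hp hφpos hg
    exact ⟨(hb.integrable hp hφpos).1,
      ⟨hg.1, (htop g _ hb).trans_lt (ENNReal.mul_lt_top ENNReal.ofReal_lt_top
        ENNReal.ofReal_lt_top)⟩,
      (hsemi g _ hb).trans_lt (ENNReal.mul_lt_top ENNReal.ofReal_lt_top ENNReal.ofReal_lt_top)⟩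
  refine ⟨Subset.antisymm (fun g hg => ?_) (fun g hg => ?_), C₁ + (C₂ + C₃), by positivity,
    fun g hg => ⟨?_, ?_⟩⟩
  · obtain ⟨h1, h2, h3⟩ := hsub g hg
    exact ⟨⟨memLp_one_iff_integrable.2 h1, h3⟩, h2⟩
  · obtain ⟨⟨h1, h3⟩, h2⟩ := hg
    refine ⟨h1.1, fun f hf => ?_⟩
    have hfi := memLp_one_iff_integrable.1 hf.1
    have hfg : Integrable (f * g) P := hfi.mul_of_top_left h2
    refine ⟨memLp_one_iff_integrable.2 hfg,
      (hup f g hfi (memLp_one_iff_integrable.1 h1) hfg).trans_lt ?_⟩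
    exact ENNReal.mul_lt_top (ENNReal.mul_lt_top ENNReal.ofReal_lt_top
      (ENNReal.add_lt_top.2 ⟨h3, h2.2⟩)) hf.2
  · obtain ⟨h1, h2, h3⟩ := hsub g hg
    have hb : IsMultiplierBound P ℱ p φ g (ENNReal.ofReal C₁ *
        (campanatoSeminorm P ℱ p (fun r => φ r / lowerStar φ r) g + eLpNorm g ∞ P)) :=
      fun f hf _ => ⟨hf.mul_of_top_left h2, hup f g hf h1 (hf.mul_of_top_left h2)⟩
    refine hb.multiplierNorm_le.trans ?_
    gcongr
    linarith
  · have hb := isMultiplierBound_multiplierNorm hF hp hφ1 hg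
    refine (add_le_add (hsemi g _ hb) (htop g _ hb)).trans ?_
    rw [← add_mul, ← ENNReal.ofReal_add hC₃.le hC₂.le]
    exact mul_le_mul_left (ENNReal.ofReal_le_ofReal (by linarith)) _
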